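/- Let $m\ge 0$ and $\omega(\mathbf k)=\sqrt{m^2+|\mathbf k|^2}$, and let $M=\mathbb R^3$ if $m>0$, $M=\mathbb R^3\setminus\{0\}$ if $m=0$, with the Poincaré group $\mathrm{ISO}^+(3,1)$ acting on $M$ through the Lorentz action on four-momenta $(\omega(\mathbf k),\mathbf k)$. Let $\pi:E\to M$ be a particle bundle of mass $m$: a smooth Hermitian vector bundle of finite rank with a smooth action $\Sigma$ of $\mathrm{ISO}^+(3,1)$ by fibrewise linear unitary maps $\Sigma_\Lambda:E(\mathbf k)\to E(\Lambda\mathbf k)$, in which a translation by $(a^0,\mathbf a)$ acts on $E(\mathbf k)$ as multiplication by $e^{i(\omega a^0-\mathbf k\cdot\mathbf a)}$. (Elementary particles are the irreducible ones; irreducibility is not needed.) On smooth sections put $(\tilde\Sigma_\Lambda\psi)(\mathbf k)=\Sigma_\Lambda[\psi(\Lambda^{-1}\mathbf k)]$, $J_a=i\frac{d}{dt}|_{0}\tilde\Sigma_{R_a(t)}$ and $K_a=-i\frac{d}{dt}|_{0}\tilde\Sigma_{\Lambda_a(t)}$, where $R_a(t)$ is the rotation by $t$ about the $a$-th axis and $\Lambda_a(t)$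 the boost along it with rapidity $t$, and let $\mathbf P$, $H$ be multiplication by $\mathbf k$, $\omega$. For a vector field $\mathbf X$ write $\mathbf X\cdot\mathbf J=X^aJ_a$, and likewise for $\mathbf K$ and $\mathbf P$. The boost connection is $$D^K_{\mathbf X}=-\frac{i}{H}\,\mathbf X\cdot\Big(\mathbf K-\frac{i\mathbf P}{2H}\Big),\qquad F_K(\mathbf X,\mathbf Y)=D^K_{\mathbf X}D^K_{\mathbf Y}-D^K_{\mathbf Y}D^K_{\mathbf X}-D^K_{[\mathbf X,\mathbf Y]}$$ is its curvature, where $[\mathbf X,\mathbf Y]$ is the Lie bracket of vector fields. 1. Let $\mathbf k_0\in M$, $\mathbf k_0\neq0$, and let $(\mathbf u_1,\mathbf u_2,\mathbf u_3)$ be a right-handed orthonormal basis of $\mathbb R^3$ with $\mathbf u_3=\mathbf k_0/|\mathbf k_0|$. Then at $\mathbf k_0$ $$F_K(\mathbf u_1,\mathbf u_2)=\frac{i}{H^2}J_3,\qquad J_3=\mathbf u_3\cdot\mathbf J,$$ that is, $(F_K(\mathbf X,\mathbf Y)\psi)(\mathbf k_0)=\frac{i}{\omega(\mathbf k_0)^2}(J_3\psi)(\mathbf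 k_0)$ for every smooth section $\psi$ and all vector fields $\mathbf X,\mathbf Y$ that are smooth near $\mathbf k_0$ (for instance constant) with $\mathbf X(\mathbf k_0)=\mathbf u_1$, $\mathbf Y(\mathbf k_0)=\mathbf u_2$. 2. For the spherical unit vector fields $\mathbf e_\theta,\mathbf e_\phi$, at all $\mathbf k$ off the polar axis, $F_K(\mathbf e_\theta,\mathbf e_\phi)=\frac{i}{H^2}J_k$ with $J_k=\frac{\mathbf k}{|\mathbf k|}\cdot\mathbf J$. 3. Suppose the particle has nonzero spin or helicity, i.e. some Lorentz transformation fixing some $\mathbf k\in M$ acts nontrivially on $E(\mathbf k)$. Then $D^K$ is not $S^2$-flat: $F_K(\mathbf X,\mathbf Y)$ does not vanish for all smooth vector fields $\mathbf X,\mathbf Y$ on $M$ that are everywhere orthogonal to $\mathbf k$. Moreover neither $\mathbf L^K=-i\mathbf P\times D^K$ (that is, $L^K_a=-iD^K_{\mathbf e_a\times\mathbf k}$) nor $\mathbf S^K=\mathbf J-\mathbf L^K$ is an angular momentum operator: neither satisfies $[A_a,A_b]=i\epsilon_{abc}A_c$ for all $a,b$ on the smooth compactly supported sections. -/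

import Mathlib

open Bundle Manifold ContDiff Matrix

noncomputable section

namespace BoostCurvature

/-! ### Minkowski space, the restricted Lorentz group and the Poincaré group -/

/-- Momentum space `ℝ³` with its Euclidean norm. -/
abbrev Vec3 : Type := EuclideanSpace ℝ (Fin 3)

/-- Cross product on `Vec3`. -/
def cross (u v : Vec3) : Vec3 := WithLp.toLp 2 (u.ofLp ⨯₃ v.ofLp)

/-- Standard basis vectors of `ℝ³`. -/
def basisVec (a : Fin 3) : Vec3 := EuclideanSpace.single a 1

/-- The Minkowski metric `diag(1, -1, -1, -1)`; index `0` is time. -/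
def minkowski : Matrix (Fin 4) (Fin 4) ℝ := Matrix.diagonal ![1, -1, -1, -1]

lemma minkowski_sq : minkowski * minkowski = 1 := by
  ext i j
  fin_cases i <;> fin_cases j <;> simp [minkowski]

/-- If `A` preserves the Minkowski form then so does `Aᵀ`. -/
lemma lorentz_transpose {A : Matrix (Fin 4) (Fin 4) ℝ}
    (h : Aᵀ * minkowski * A = minkowski) : A * minkowski * Aᵀ = minkowski := by
  have h1 : (minkowski * Aᵀ * minkowski) * A = 1 := by
    calc (minkowski * Aᵀ * minkowski) * A = minkowski * (Aᵀ * minkowski * A) := by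
          simp only [Matrix.mul_assoc]
      _ = 1 := by rw [h, minkowski_sq]
  have h2 : A * (minkowski * Aᵀ * minkowski) = 1 := mul_eq_one_comm.mp h1
  calc A * minkowski * Aᵀ = (A * (minkowski * Aᵀ * minkowski)) * minkowski := by
        simp only [Matrix.mul_assoc, minkowski_sq, Matrix.mul_one]
    _ = minkowski := by rw [h2, Matrix.one_mul]

lemma lorentz_row {A : Matrix (Fin 4) (Fin 4) ℝ}
    (h : Aᵀ * minkowski * A = minkowski) :
    A 0 0 ^ 2 = 1 + (A 0 1 ^ 2 + A 0 2 ^ 2 + A 0 3 ^ 2) := by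
  have h1 := congrFun (congrFun (lorentz_transpose h) 0) 0
  simp [Matrix.mul_apply, Fin.sum_univ_succ, minkowski, Matrix.diagonal_apply] at h1
  linarith

/-- A Lorentz matrix with positive time-time entry maps future causal vectors with positive time
component to vectors with positive time component. -/
lemma lorentz_time_pos {A : Matrix (Fin 4) (Fin 4) ℝ}
    (h : Aᵀ * minkowski * A = minkowski) (h0 : 0 < A 0 0) {p : Fin 4 → ℝ} (hp : 0 < p 0)
    (hc : p 1 ^ 2 + p 2 ^ 2 + p 3 ^ 2 ≤ p 0 ^ 2) : 0 < (A *ᵥ p) 0 := by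
  have hr := lorentz_row h
  have hs : (A *ᵥ p) 0 = A 0 0 * p 0 + (A 0 1 * p 1 + A 0 2 * p 2 + A 0 3 * p 3) := by
    simp [Matrix.mulVec, dotProduct, Fin.sum_univ_succ]
    ring
  rw [hs]
  set s := A 0 1 * p 1 + A 0 2 * p 2 + A 0 3 * p 3 with hsdef
  have hcs : s ^ 2 ≤ (A 0 1 ^ 2 + A 0 2 ^ 2 + A 0 3 ^ 2) * (p 1 ^ 2 + p 2 ^ 2 + p 3 ^ 2) := by
    rw [hsdef]
    nlinarith [sq_nonneg (A 0 1 * p 2 - A 0 2 * p 1), sq_nonneg (A 0 1 * p 3 - A 0 3 * p 1),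
      sq_nonneg (A 0 2 * p 3 - A 0 3 * p 2)]
  have hlt : s ^ 2 < (A 0 0 * p 0) ^ 2 := by
    have hq : 0 < p 0 ^ 2 := by positivity
    have hn : 0 ≤ A 0 1 ^ 2 + A 0 2 ^ 2 + A 0 3 ^ 2 := by positivity
    calc s ^ 2 ≤ (A 0 1 ^ 2 + A 0 2 ^ 2 + A 0 3 ^ 2) * (p 1 ^ 2 + p 2 ^ 2 + p 3 ^ 2) := hcs
      _ ≤ (A 0 1 ^ 2 + A 0 2 ^ 2 + A 0 3 ^ 2) * p 0 ^ 2 := by gcongr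
      _ < (A 0 0 * p 0) ^ 2 := by rw [mul_pow, hr]; nlinarith
  have := abs_lt_of_sq_lt_sq' hlt (by positivity)
  linarith [this.1]

/-- The Minkowski square is preserved. -/
lemma lorentz_norm {A : Matrix (Fin 4) (Fin 4) ℝ}
    (h : Aᵀ * minkowski * A = minkowski) (p : Fin 4 → ℝ) :
    (A *ᵥ p) ⬝ᵥ (minkowski *ᵥ (A *ᵥ p)) = p ⬝ᵥ (minkowski *ᵥ p) := by
  rw [Matrix.mulVec_mulVec, ← Matrix.vecMul_transpose, ← Matrix.dotProduct_mulVec,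
    Matrix.mulVec_mulVec, ← Matrix.mul_assoc, h]

lemma minkowski_form (p : Fin 4 → ℝ) :
    p ⬝ᵥ (minkowski *ᵥ p) = p 0 ^ 2 - (p 1 ^ 2 + p 2 ^ 2 + p 3 ^ 2) := by
  simp [dotProduct, Matrix.mulVec, Fin.sum_univ_succ, minkowski, Matrix.diagonal_apply]
  ring

/-- The proper orthochronous Lorentz group `SO⁺(3,1)`: determinant one, preserving the Minkowski
form and the direction of time. -/
def RestrictedLorentz : Subgroup (Matrix.SpecialLinearGroup (Fin 4) ℝ) where
  carrier := {A | (A : Matrix (Fin 4) (Fin 4) ℝ)ᵀ * minkowski * (A : Matrix _ _ ℝ) = minkowski ∧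
    0 < (A : Matrix (Fin 4) (Fin 4) ℝ) 0 0}
  one_mem' := by simp
  mul_mem' := by
    rintro A B ⟨hA, hA0⟩ ⟨hB, hB0⟩
    refine ⟨?_, ?_⟩
    · simp only [Matrix.SpecialLinearGroup.coe_mul, Matrix.transpose_mul]
      calc _ = (B : Matrix (Fin 4) (Fin 4) ℝ)ᵀ * ((A : Matrix (Fin 4) (Fin 4) ℝ)ᵀ * minkowski *
              (A : Matrix (Fin 4) (Fin 4) ℝ)) * (B : Matrix (Fin 4) (Fin 4) ℝ) := by
            simp only [Matrix.mul_assoc]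
        _ = minkowski := by rw [hA, hB]
    · have h1 := congrFun (congrFun hB 0) 0
      simp [Matrix.mul_apply, Fin.sum_univ_succ, minkowski, Matrix.diagonal_apply] at h1
      have := lorentz_time_pos hA hA0 (p := fun i => (B : Matrix (Fin 4) (Fin 4) ℝ) i 0) hB0
        (by nlinarith)
      simpa [Matrix.mulVec, dotProduct, Matrix.mul_apply] using this
  inv_mem' := by
    rintro A ⟨hA, hA0⟩
    have hl : (minkowski * (A : Matrix (Fin 4) (Fin 4) ℝ)ᵀ * minkowski) *
        (A : Matrix (Fin 4) (Fin 4) ℝ) = 1 := by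
      calc _ = minkowski * ((A : Matrix (Fin 4) (Fin 4) ℝ)ᵀ * minkowski *
              (A : Matrix (Fin 4) (Fin 4) ℝ)) := by simp only [Matrix.mul_assoc]
        _ = 1 := by rw [hA, minkowski_sq]
    have hr : (A : Matrix (Fin 4) (Fin 4) ℝ) * ((A⁻¹ : Matrix.SpecialLinearGroup (Fin 4) ℝ) :
        Matrix (Fin 4) (Fin 4) ℝ) = 1 := by
      rw [← Matrix.SpecialLinearGroup.coe_mul, mul_inv_cancel, Matrix.SpecialLinearGroup.coe_one]
    have hinv : ((A⁻¹ : Matrix.SpecialLinearGroup (Fin 4) ℝ) : Matrix (Fin 4) (Fin 4) ℝ) =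
        minkowski * (A : Matrix (Fin 4) (Fin 4) ℝ)ᵀ * minkowski :=
      (left_inv_eq_right_inv hl hr).symm
    have htr := lorentz_transpose hA
    have hmt : minkowskiᵀ = minkowski := by simp [minkowski]
    refine ⟨?_, ?_⟩
    · simp only [hinv, Matrix.transpose_mul, Matrix.transpose_transpose, hmt]
      calc _ = minkowski * (A : Matrix (Fin 4) (Fin 4) ℝ) * (minkowski * (minkowski * minkowski)) *
              (A : Matrix (Fin 4) (Fin 4) ℝ)ᵀ * minkowski := by simp only [Matrix.mul_assoc]
        _ = minkowski * ((A : Matrix (Fin 4) (Fin 4) ℝ) * minkowski *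
              (A : Matrix (Fin 4) (Fin 4) ℝ)ᵀ) * minkowski := by
            rw [minkowski_sq, Matrix.mul_one]; simp only [Matrix.mul_assoc]
        _ = minkowski := by rw [htr, minkowski_sq, Matrix.one_mul]
    · rw [hinv]
      simpa [Matrix.mul_apply, minkowski, Matrix.diagonal_apply] using hA0

/-- The `4 × 4` matrix of a restricted Lorentz transformation. -/
def lorMat (Λ : RestrictedLorentz) : Matrix (Fin 4) (Fin 4) ℝ :=
  (Λ : Matrix.SpecialLinearGroup (Fin 4) ℝ).1

lemma lorMat_form (Λ : RestrictedLorentz) : (lorMat Λ)ᵀ * minkowski * lorMat Λ = minkowski :=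
  Λ.2.1

lemma lorMat_pos (Λ : RestrictedLorentz) : 0 < lorMat Λ 0 0 := Λ.2.2

lemma lorMat_mul (Λ Λ' : RestrictedLorentz) : lorMat (Λ * Λ') = lorMat Λ * lorMat Λ' := rfl

lemma lorMat_one : lorMat 1 = 1 := rfl

/-- The proper orthochronous Poincaré group `ISO⁺(3,1)`: the element with translation part `a` and
Lorentz part `Λ` acts on spacetime as `x ↦ Λ x + a`. -/
@[ext] structure Poincare where
  /-- translation part -/
  trans : Fin 4 → ℝ
  /-- Lorentz part -/
  lor : RestrictedLorentz

instance : Group Poincare where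
  mul g h := ⟨g.trans + lorMat g.lor *ᵥ h.trans, g.lor * h.lor⟩
  one := ⟨0, 1⟩
  inv g := ⟨-(lorMat g.lor⁻¹ *ᵥ g.trans), g.lor⁻¹⟩
  mul_assoc g h k := by
    refine Poincare.ext ?_ (mul_assoc _ _ _)
    change (g.trans + lorMat g.lor *ᵥ h.trans) + lorMat (g.lor * h.lor) *ᵥ k.trans =
      g.trans + lorMat g.lor *ᵥ (h.trans + lorMat h.lor *ᵥ k.trans)
    rw [lorMat_mul, Matrix.mulVec_add, Matrix.mulVec_mulVec, add_assoc]
  one_mul g := by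
    refine Poincare.ext ?_ (one_mul _)
    change 0 + lorMat 1 *ᵥ g.trans = g.trans
    rw [lorMat_one, Matrix.one_mulVec, zero_add]
  mul_one g := by
    refine Poincare.ext ?_ (mul_one _)
    change g.trans + lorMat g.lor *ᵥ 0 = g.trans
    rw [Matrix.mulVec_zero, add_zero]
  inv_mul_cancel g := by
    refine Poincare.ext ?_ (inv_mul_cancel _)
    change -(lorMat g.lor⁻¹ *ᵥ g.trans) + lorMat g.lor⁻¹ *ᵥ g.trans = 0
    exact neg_add_cancel _

/-- Lorentz transformations as elements of the Poincaré group. -/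
def Poincare.ofLorentz (Λ : RestrictedLorentz) : Poincare := ⟨0, Λ⟩

/-- Spacetime translations as elements of the Poincaré group. -/
def Poincare.ofTranslation (a : Fin 4 → ℝ) : Poincare := ⟨a, 1⟩

/-- A smooth family of Poincaré transformations parametrised by `ℝⁿ`. -/
def Poincare.SmoothFamily {n : ℕ} (γ : EuclideanSpace ℝ (Fin n) → Poincare) : Prop :=
  (∀ i, ContDiff ℝ ∞ fun x => (γ x).trans i) ∧
    ∀ i j, ContDiff ℝ ∞ fun x => lorMat (γ x).lor i j

/-- Matrix of the right-handed rotation by the angle `t` about the `a`-th coordinate axis. -/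
def rotationMatrix (a : Fin 3) (t : ℝ) : Matrix (Fin 4) (Fin 4) ℝ :=
  match a with
  | 0 => !![1, 0, 0, 0; 0, 1, 0, 0; 0, 0, Real.cos t, -Real.sin t; 0, 0, Real.sin t, Real.cos t]
  | 1 => !![1, 0, 0, 0; 0, Real.cos t, 0, Real.sin t; 0, 0, 1, 0; 0, -Real.sin t, 0, Real.cos t]
  | 2 => !![1, 0, 0, 0; 0, Real.cos t, -Real.sin t, 0; 0, Real.sin t, Real.cos t, 0; 0, 0, 0, 1]

/-- Matrix of the (active) boost along the `a`-th coordinate axis with rapidity `t`, i.e. with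
velocity `tanh t = t + O(t³)`. -/
def boostMatrix (a : Fin 3) (t : ℝ) : Matrix (Fin 4) (Fin 4) ℝ :=
  match a with
  | 0 => !![Real.cosh t, Real.sinh t, 0, 0; Real.sinh t, Real.cosh t, 0, 0; 0, 0, 1, 0; 0, 0, 0, 1]
  | 1 => !![Real.cosh t, 0, Real.sinh t, 0; 0, 1, 0, 0; Real.sinh t, 0, Real.cosh t, 0; 0, 0, 0, 1]
  | 2 => !![Real.cosh t, 0, 0, Real.sinh t; 0, 1, 0, 0; 0, 0, 1, 0; Real.sinh t, 0, 0, Real.cosh t]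

lemma det_rotationMatrix (a : Fin 3) (t : ℝ) : (rotationMatrix a t).det = 1 := by
  have h := Real.sin_sq_add_cos_sq t
  fin_cases a <;>
    simp [rotationMatrix, Matrix.det_succ_row_zero, Fin.sum_univ_succ, Fin.succAbove] <;>
    nlinarith

lemma det_boostMatrix (a : Fin 3) (t : ℝ) : (boostMatrix a t).det = 1 := by
  have h := Real.cosh_sq t
  fin_cases a <;>
    simp [boostMatrix, Matrix.det_succ_row_zero, Fin.sum_univ_succ, Fin.succAbove] <;>
    nlinarith

/-- The rotation `R_a(t)` by the angle `t` about the `a`-th coordinate axis. -/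
def rotation (a : Fin 3) (t : ℝ) : RestrictedLorentz :=
  ⟨⟨rotationMatrix a t, det_rotationMatrix a t⟩, by
    have h := Real.sin_sq_add_cos_sq t
    refine ⟨?_, ?_⟩
    · ext i j
      fin_cases a <;> fin_cases i <;> fin_cases j <;>
        simp [rotationMatrix, minkowski, Matrix.mul_apply, Fin.sum_univ_succ,
          Matrix.diagonal_apply] <;> nlinarith
    · fin_cases a <;> simp [rotationMatrix]⟩

/-- The boost `Λ_a(t)` along the `a`-th coordinate axis. -/
def boost (a : Fin 3) (t : ℝ) : RestrictedLorentz :=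
  ⟨⟨boostMatrix a t, det_boostMatrix a t⟩, by
    have h := Real.cosh_sq t
    refine ⟨?_, ?_⟩
    · ext i j
      fin_cases a <;> fin_cases i <;> fin_cases j <;>
        simp [boostMatrix, minkowski, Matrix.mul_apply, Fin.sum_univ_succ,
          Matrix.diagonal_apply] <;> nlinarith
    · fin_cases a <;> simp [boostMatrix, Real.cosh_pos]⟩

/-! ### The mass shell, labelled by the spatial momentum -/

/-- The spatial momenta of a particle of mass `m`: all of `ℝ³` for a massive particle, and
`ℝ³ \ {0}` for a massless one. -/
def momentumSpace (m : ℝ) : TopologicalSpace.Opens Vec3 :=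
  ⟨{k | m ≠ 0 ∨ k ≠ 0}, by
    by_cases h : m = 0
    · simpa [h] using isOpen_ne
    · simp [h]⟩

/-- The energy `ω(k) = √(m² + |k|²)`. -/
def energy (m : ℝ) (k : Vec3) : ℝ := √(m ^ 2 + ‖k‖ ^ 2)

/-- The four-momentum `(ω, k)`. -/
def fourMomentum (m : ℝ) (k : Vec3) : Fin 4 → ℝ := Fin.cons (energy m k) k.ofLp

/-- The spatial part of a four-vector. -/
def spatial (p : Fin 4 → ℝ) : Vec3 := WithLp.toLp 2 (fun i => p i.succ)

lemma norm_sq_spatial (p : Fin 4 → ℝ) : ‖spatial p‖ ^ 2 = p 1 ^ 2 + p 2 ^ 2 + p 3 ^ 2 := by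
  rw [EuclideanSpace.norm_sq_eq]
  simp [spatial, Fin.sum_univ_succ]
  ring

lemma spatial_fourMomentum (m : ℝ) (k : Vec3) : spatial (fourMomentum m k) = k := rfl

lemma energy_pos {m : ℝ} (k : momentumSpace m) : 0 < energy m k := by
  refine Real.sqrt_pos.mpr ?_
  rcases k.2 with h | h
  · have := sq_pos_of_ne_zero h
    positivity
  · have := norm_pos_iff.mpr h
    positivity

lemma fourMomentum_mass {m : ℝ} (k : Vec3) :
    fourMomentum m k ⬝ᵥ (minkowski *ᵥ fourMomentum m k) = m ^ 2 := by
  have h := norm_sq_spatial (fourMomentum m k)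
  rw [spatial_fourMomentum] at h
  rw [minkowski_form, ← h]
  have : fourMomentum m k 0 = energy m k := rfl
  rw [this, energy, Real.sq_sqrt (by positivity)]
  ring

lemma lorentz_energy_pos {m : ℝ} (Λ : RestrictedLorentz) (k : momentumSpace m) :
    0 < (lorMat Λ *ᵥ fourMomentum m k) 0 := by
  refine lorentz_time_pos (lorMat_form Λ) (lorMat_pos Λ) (energy_pos k) ?_
  have := fourMomentum_mass (m := m) k
  rw [minkowski_form] at this
  nlinarith [sq_nonneg m]

lemma fourMomentum_lorentz {m : ℝ} (Λ : RestrictedLorentz) (k : momentumSpace m) :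
    fourMomentum m (spatial (lorMat Λ *ᵥ fourMomentum m k)) = lorMat Λ *ᵥ fourMomentum m k := by
  have h1 := lorentz_norm (lorMat_form Λ) (fourMomentum m k)
  rw [fourMomentum_mass, minkowski_form, ← norm_sq_spatial] at h1
  funext i
  refine Fin.cases ?_ (fun j => rfl) i
  change √(m ^ 2 + ‖spatial (lorMat Λ *ᵥ fourMomentum m k)‖ ^ 2) = _
  rw [← h1, sub_add_cancel, Real.sqrt_sq (lorentz_energy_pos Λ k).le]

lemma lorentz_mem {m : ℝ} (Λ : RestrictedLorentz) (k : momentumSpace m) :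
    spatial (lorMat Λ *ᵥ fourMomentum m k) ∈ momentumSpace m := by
  by_cases hm : m = 0
  · right
    intro h0
    have h1 := fourMomentum_lorentz Λ k
    rw [h0] at h1
    have h2 := lorentz_energy_pos Λ k
    rw [← h1] at h2
    simp [fourMomentum, energy, hm] at h2
  · exact Or.inl hm

/-- The Poincaré group acts on momenta through the linear action of its Lorentz part on
four-momenta. -/
instance (m : ℝ) : MulAction Poincare (momentumSpace m) where
  smul g k := ⟨spatial (lorMat g.lor *ᵥ fourMomentum m k), lorentz_mem g.lor k⟩
  one_smul k := by
    refine Subtype.ext ?_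
    change spatial (lorMat 1 *ᵥ fourMomentum m k) = k
    rw [lorMat_one, Matrix.one_mulVec, spatial_fourMomentum]
  mul_smul g h k := by
    refine Subtype.ext ?_
    change spatial (lorMat (g.lor * h.lor) *ᵥ fourMomentum m k) =
      spatial (lorMat g.lor *ᵥ fourMomentum m (spatial (lorMat h.lor *ᵥ fourMomentum m k)))
    rw [fourMomentum_lorentz, lorMat_mul, Matrix.mulVec_mulVec]

lemma translation_smul {m : ℝ} (a : Fin 4 → ℝ) (k : momentumSpace m) :
    Poincare.ofTranslation a • k = k := by
  refine Subtype.ext ?_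
  change spatial (lorMat 1 *ᵥ fourMomentum m k) = k
  rw [lorMat_one, Matrix.one_mulVec, spatial_fourMomentum]

/-! ### Particle bundles -/

section Bundles

variable {m : ℝ} {F : Type*} [NormedAddCommGroup F] [NormedSpace ℂ F]
  {E : momentumSpace m → Type*} [TopologicalSpace (TotalSpace F E)]
  [∀ k, NormedAddCommGroup (E k)] [∀ k, InnerProductSpace ℂ (E k)]
  [FiberBundle F E]

variable (F) in
/-- Smooth sections of `E` (smooth wave functions). -/
def IsSmoothSection (ψ : ∀ k, E k) : Prop :=
  ContMDiff 𝓘(ℝ, Vec3) (𝓘(ℝ, Vec3).prod 𝓘(ℝ, F)) ∞ (fun k => TotalSpace.mk' F k (ψ k))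

/-- Sections with compact support. -/
def HasCompactSupp (ψ : ∀ k, E k) : Prop := IsCompact (closure {k | ψ k ≠ 0})

variable (F E) in
/-- A smooth unitary representation of the Poincaré group on the bundle `E` of internal states over
the momenta of mass `m`, covering the action on momenta. `E` is a smooth Hermitian vector bundle,
`act g h : E k → E k'` is the fibre map `Σ_g` for `h : g • k = k'`. A particle of mass `m` is such a
representation (an irreducible one if it is elementary). -/
structure BundleRep where
  /-- the Hermitian product is smooth -/
  smooth_inner : ∀ ψ χ : (∀ k, E k), IsSmoothSection F ψ → IsSmoothSection F χ →
    ContMDiff 𝓘(ℝ, Vec3) 𝓘(ℝ, ℂ) ∞ (fun k => inner ℂ (ψ k) (χ k))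
  /-- the linear map `Σ_g` between fibres -/
  act : ∀ (g : Poincare) {k k' : momentumSpace m}, g • k = k' → (E k →ₗ[ℂ] E k')
  act_one : ∀ (k : momentumSpace m) (v : E k), act 1 (one_smul Poincare k) v = v
  act_mul : ∀ (g h : Poincare) {k k' k'' : momentumSpace m} (hk : h • k = k') (gk : g • k' = k'')
    (v : E k), act (g * h) (by rw [mul_smul, hk, gk]) v = act g gk (act h hk v)
  /-- unitarity -/
  inner_act : ∀ (g : Poincare) {k k' : momentumSpace m} (h : g • k = k') (v w : E k),
    inner ℂ (act g h v) (act g h w) = inner ℂ v w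
  /-- `E k` consists of states with four-momentum `(ω, k)` -/
  act_translation : ∀ (a : Fin 4 → ℝ) (k : momentumSpace m) (v : E k),
    act (Poincare.ofTranslation a) (translation_smul a k) v =
      Complex.exp (Complex.I * ((energy m k * a 0 - ∑ i, (k : Vec3) i * a i.succ : ℝ) : ℂ)) • v
  /-- the action `(g, (k, v)) ↦ (g k, Σ_g v)` on the total space is smooth -/
  smooth_act : ∀ (n : ℕ) (γ : EuclideanSpace ℝ (Fin n) → Poincare), Poincare.SmoothFamily γ →
    ContMDiff (𝓘(ℝ, EuclideanSpace ℝ (Fin n)).prod (𝓘(ℝ, Vec3).prod 𝓘(ℝ, F)))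
      (𝓘(ℝ, Vec3).prod 𝓘(ℝ, F)) ∞
      (fun q : EuclideanSpace ℝ (Fin n) × TotalSpace F E =>
        TotalSpace.mk' F (γ q.1 • q.2.proj) (act (γ q.1) rfl q.2.snd))

namespace BundleRep

variable (ρ : BundleRep F E)

/-- The particle has nonzero spin (or helicity): the little group of some momentum acts
nontrivially on the internal states with that momentum. -/
def HasNonzeroSpin : Prop :=
  ∃ (k : momentumSpace m) (Λ : RestrictedLorentz) (h : Poincare.ofLorentz Λ • k = k) (v : E k),
    ρ.act (Poincare.ofLorentz Λ) h v ≠ v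

/-- The induced action on sections, `(Σ̃_g ψ)(k) = Σ_g (ψ (g⁻¹ k))`. -/
def sectionAct (g : Poincare) (ψ : ∀ k, E k) : ∀ k, E k :=
  fun k => ρ.act g (smul_inv_smul g k) (ψ (g⁻¹ • k))

/-- Angular momentum `J_a = i d/dt|₀ Σ̃(R_a(t))`. -/
def J (a : Fin 3) (ψ : ∀ k, E k) : ∀ k, E k := fun k =>
  Complex.I • deriv (fun t : ℝ => ρ.sectionAct (Poincare.ofLorentz (rotation a t)) ψ k) 0

/-- Boost generator `K_a = -i d/dt|₀ Σ̃(Λ_a(t))`. -/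
def K (a : Fin 3) (ψ : ∀ k, E k) : ∀ k, E k := fun k =>
  (-Complex.I) • deriv (fun t : ℝ => ρ.sectionAct (Poincare.ofLorentz (boost a t)) ψ k) 0

/-- `X · J` for a vector field `X`. -/
def dotJ (X : Vec3 → Vec3) (ψ : ∀ k, E k) : ∀ k, E k := fun k =>
  ∑ a, ((X k a : ℝ) : ℂ) • ρ.J a ψ k

/-- `X · K` for a vector field `X`. -/
def dotK (X : Vec3 → Vec3) (ψ : ∀ k, E k) : ∀ k, E k := fun k =>
  ∑ a, ((X k a : ℝ) : ℂ) • ρ.K a ψ k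

/-- The boost connection `D^K = -(i/H) (K - i P / (2 H))` in direction of the vector field `X`,
where `P` and `H` are multiplication by `k` and `ω`. -/
def boostConnection (X : Vec3 → Vec3) (ψ : ∀ k, E k) : ∀ k, E k := fun k =>
  (-(Complex.I / (energy m k : ℂ))) •
    (ρ.dotK X ψ k -
      (Complex.I * ((∑ a, X k a * (k : Vec3) a : ℝ) : ℂ) / (2 * (energy m k : ℂ))) • ψ k)

end BundleRep

/-- The curvature `F(X, Y) ψ = D_X D_Y ψ - D_Y D_X ψ - D_[X,Y] ψ` of an operator `D` taking a vector
field and a section to a section. -/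
def curvature (D : (Vec3 → Vec3) → (∀ k, E k) → ∀ k, E k) (X Y : Vec3 → Vec3)
    (ψ : ∀ k, E k) : ∀ k, E k := fun k =>
  D X (D Y ψ) k - D Y (D X ψ) k - D (VectorField.lieBracket ℝ X Y) ψ k

variable (F) in
/-- `D` is `S²`-flat if its curvature vanishes on all smooth vector fields on the base which are
everywhere orthogonal to `k`. -/
def IsS2Flat (D : (Vec3 → Vec3) → (∀ k, E k) → ∀ k, E k) : Prop :=
  ∀ X Y : Vec3 → Vec3, ContDiffOn ℝ ∞ X (momentumSpace m) → ContDiffOn ℝ ∞ Y (momentumSpace m) →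
    (∀ k : momentumSpace m, inner ℝ (X k) (k : Vec3) = 0) →
    (∀ k : momentumSpace m, inner ℝ (Y k) (k : Vec3) = 0) →
    ∀ ψ : (∀ k, E k), IsSmoothSection F ψ → ∀ k, curvature D X Y ψ k = 0

/-- The orbital part `L = -i k × D` induced by `D`: `L_a = -i D_{e_a × k}`. -/
def orbitalPart (D : (Vec3 → Vec3) → (∀ k, E k) → ∀ k, E k) (a : Fin 3) (ψ : ∀ k, E k) :
    ∀ k, E k := fun k => (-Complex.I) • D (fun p => cross (basisVec a) p) ψ k

/-- The spin part `S = J - L` induced by `D`. -/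
def spinPart (ρ : BundleRep F E) (D : (Vec3 → Vec3) → (∀ k, E k) → ∀ k, E k) (a : Fin 3)
    (ψ : ∀ k, E k) : ∀ k, E k := fun k => ρ.J a ψ k - orbitalPart D a ψ k

/-- The Levi-Civita symbol `ε_abc = (e_a × e_b) · e_c`. -/
def leviCivita (a b c : Fin 3) : ℝ := cross (basisVec a) (basisVec b) c

variable (F) in
/-- The triple `A` satisfies the angular momentum relations `[A_a, A_b] = i ε_abc A_c`
on the smooth wave functions of compact support. -/
def IsAngularMomentum (A : Fin 3 → (∀ k, E k) → ∀ k, E k) : Prop :=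
  ∀ ψ : (∀ k, E k), IsSmoothSection F ψ → HasCompactSupp ψ → ∀ (a b : Fin 3) (k : momentumSpace m),
    A a (A b ψ) k - A b (A a ψ) k =
      ∑ c, (Complex.I * (leviCivita a b c : ℂ)) • A c ψ k

end Bundles

/-! ### Spherical unit vectors, for `k` off the third coordinate axis -/

/-- The distance `√(k₁² + k₂²) = |k| sin θ` to the third axis. -/
def axisDist (k : Vec3) : ℝ := √(k 0 ^ 2 + k 1 ^ 2)

def cosTheta (k : Vec3) : ℝ := k 2 / ‖k‖
def sinTheta (k : Vec3) : ℝ := axisDist k / ‖k‖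
def cosPhi (k : Vec3) : ℝ := k 0 / axisDist k
def sinPhi (k : Vec3) : ℝ := k 1 / axisDist k

/-- The unit vector `k / |k|`. -/
def unitK (k : Vec3) : Vec3 := ‖k‖⁻¹ • k

def unitTheta (k : Vec3) : Vec3 :=
  !₂[cosTheta k * cosPhi k, cosTheta k * sinPhi k, -sinTheta k]

def unitPhi (k : Vec3) : Vec3 := !₂[-sinPhi k, cosPhi k, 0]

end BoostCurvature

end

open BoostCurvature

noncomputable section

namespace BoostCurvature

attribute [local instance] Matrix.linftyOpNormedRing Matrix.linftyOpNormedAlgebra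

/-! ### The Lorentz algebra and its exponential map -/

/-! For a Lorentz algebra element Z let ρ(Z)ψ be the derivative at t = 0 of the action of exp(tZ) on
a section ψ (`infAct`), and let R_a, B_a be its values at the rotation and boost generators, with
axes numbered 0, 1, 2. Then J_a = i R_a and K_a = -i B_a. At a fixed momentum this is the derivative
of a curve in a single fibre, so ordinary calculus applies. Two facts are needed: ρ(Z) obeys a
Leibniz rule along the vector field -Zk on momentum space (`HasInfAct.smul`), and ρ respects
brackets (`infAct_commutator`). The latter comes from differentiating exp(sA) exp(tB) = exp(t Ad(exp
sA) B) exp(sA) in t and then in s.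

In these terms D_X = -(1/ω) X·B - (X·k)/(2ω²). The scalar term is the closed form -½ d log ω and
contributes no curvature. A boost along the axis b moves k with velocity ω e_b. Hence the
derivatives of X and Y cancel against the Lie bracket, those of 1/ω leave terms proportional to X·k
and Y·k, and [B_a, B_b] = -ε_abc R_c leaves -(X × Y)·R/ω² (`curvature_boostConnection`). When X and
Y are orthogonal to k at the point, only the last term survives; since R = -iJ it is (i/ω²)(X ×
Y)·J. This gives the first two claims.

For the third claim let X_a = e_a × k, which is orthogonal to k. Both [L_0, L_1] - iL_2 and [S_0,
S_1] - iS_2 equal -F(X_0, X_1), so each of the three properties to be refuted makes F(X_0, X_1)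
vanish on compactly supported smooth sections. At k = s e_2 this curvature is -(s²/ω²) R_2. Hence
R_2 vanishes on the fibres over the last axis away from the origin, and the rotations about that
axis act trivially there (`fixesFibre_rotation`).

This trivialises every little group (`not_hasNonzeroSpin`). For m = 0 the little group of a momentum
on the axis consists of products of rotations and null rotations, and a null rotation is a product
of a half turn and a conjugate of a half turn. For m > 0 triviality passes to k = 0 by continuity,
and Euler angles write the little group SO(3) in terms of conjugates of the same rotations. Little
groups of different momenta on an orbit are conjugate. -/

/-- The Lie algebra of the Lorentz group. -/
def lorentzAlgebra : Submodule ℝ (Matrix (Fin 4) (Fin 4) ℝ) where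
  carrier := {Z | Zᵀ * minkowski + minkowski * Z = 0}
  zero_mem' := by simp
  add_mem' := by
    intro A B hA hB
    simp only [Set.mem_ofPred_eq] at *
    rw [Matrix.transpose_add, add_mul, mul_add]
    calc _ = (Aᵀ * minkowski + minkowski * A) + (Bᵀ * minkowski + minkowski * B) := by abel
      _ = 0 := by rw [hA, hB, add_zero]
  smul_mem' := by
    intro c A hA
    simp only [Set.mem_ofPred_eq] at *
    rw [Matrix.transpose_smul, smul_mul_assoc, mul_smul_comm, ← smul_add, hA, smul_zero]

lemma mem_lorentzAlgebra {Z : Matrix (Fin 4) (Fin 4) ℝ} :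
    Z ∈ lorentzAlgebra ↔ Zᵀ * minkowski + minkowski * Z = 0 := Iff.rfl

lemma lorentzAlgebra_conj {Z : Matrix (Fin 4) (Fin 4) ℝ} (hZ : Z ∈ lorentzAlgebra) :
    Zᵀ = minkowski * (-Z) * minkowski := by
  have h := mem_lorentzAlgebra.mp hZ
  calc Zᵀ = (Zᵀ * minkowski) * minkowski := by
        rw [Matrix.mul_assoc, minkowski_sq, Matrix.mul_one]
    _ = _ := by rw [eq_neg_of_add_eq_zero_left h, mul_neg]

lemma minkowski_inv : minkowski⁻¹ = minkowski := Matrix.inv_eq_left_inv minkowski_sq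

lemma isUnit_minkowski : IsUnit minkowski :=
  ⟨⟨minkowski, minkowski, minkowski_sq, minkowski_sq⟩, rfl⟩

/-- Zᵀ is the conjugate of -Z by the metric, so exp(Z)ᵀ is the conjugate of exp(-Z). -/
lemma exp_form {Z : Matrix (Fin 4) (Fin 4) ℝ} (hZ : Z ∈ lorentzAlgebra) :
    (NormedSpace.exp Z)ᵀ * minkowski * NormedSpace.exp Z = minkowski := by
  have h := Matrix.exp_conj minkowski (-Z) isUnit_minkowski
  rw [minkowski_inv] at h
  rw [← Matrix.exp_transpose, lorentzAlgebra_conj hZ, h]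
  calc _ = minkowski * NormedSpace.exp (-Z) * (minkowski * minkowski) * NormedSpace.exp Z := by
        simp only [Matrix.mul_assoc]
    _ = minkowski * (NormedSpace.exp (-Z) * NormedSpace.exp Z) := by
        rw [minkowski_sq, Matrix.mul_one, Matrix.mul_assoc]
    _ = minkowski := by
        rw [← Matrix.exp_add_of_commute _ _ (Commute.neg_left (Commute.refl Z)), neg_add_cancel,
          NormedSpace.exp_zero, Matrix.mul_one]

/-- An exponential is the square of a matrix preserving the form. This gives determinant one and a
positive time-time entry without a connectedness argument. -/
lemma exp_eq_sq (Z : Matrix (Fin 4) (Fin 4) ℝ) : NormedSpace.exp Z =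
    NormedSpace.exp ((1 / 2 : ℝ) • Z) * NormedSpace.exp ((1 / 2 : ℝ) • Z) := by
  rw [← Matrix.exp_add_of_commute _ _ (Commute.refl _), ← add_smul]
  norm_num

lemma det_sq_of_form {A : Matrix (Fin 4) (Fin 4) ℝ} (h : Aᵀ * minkowski * A = minkowski) :
    A.det * A.det = 1 := by
  have h1 := congrArg Matrix.det h
  have h2 := congrArg Matrix.det minkowski_sq
  rw [Matrix.det_mul, Matrix.det_mul, Matrix.det_transpose] at h1
  rw [Matrix.det_mul, Matrix.det_one] at h2
  have h3 : A.det * A.det * (minkowski.det * minkowski.det) = minkowski.det * minkowski.det := by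
    linear_combination minkowski.det * h1
  rwa [h2, mul_one] at h3

/-- The time-time entry of A is nonzero, and A and -A have the same square, so it may be taken
positive; then A maps its own first column, a future timelike vector, to a future vector. -/
lemma sq_time_pos {A : Matrix (Fin 4) (Fin 4) ℝ} (h : Aᵀ * minkowski * A = minkowski) :
    0 < (A * A) 0 0 := by
  have key : ∀ B : Matrix (Fin 4) (Fin 4) ℝ, Bᵀ * minkowski * B = minkowski → 0 < B 0 0 →
      0 < (B * B) 0 0 := by
    intro B hB hB0
    have h1 := congrFun (congrFun hB 0) 0
    simp [Matrix.mul_apply, Fin.sum_univ_succ, minkowski, Matrix.diagonal_apply] at h1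
    have := lorentz_time_pos hB hB0 (p := fun i => B i 0) hB0 (by nlinarith)
    simpa [Matrix.mulVec, dotProduct, Matrix.mul_apply] using this
  have h0 : A 0 0 ≠ 0 := by
    intro h0
    have := lorentz_row h
    rw [h0] at this
    nlinarith [sq_nonneg (A 0 1), sq_nonneg (A 0 2), sq_nonneg (A 0 3)]
  rcases lt_or_gt_of_ne h0 with h0 | h0
  · have := key (-A) (by simpa using h) (by simpa using h0)
    simpa using this
  · exact key A h h0

/-- The exponential map of the restricted Lorentz group. -/
def lorentzExp (Z : lorentzAlgebra) : RestrictedLorentz :=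
  ⟨⟨NormedSpace.exp (Z : Matrix (Fin 4) (Fin 4) ℝ), by
    have h := exp_form (lorentzAlgebra.smul_mem (1 / 2) Z.2)
    rw [exp_eq_sq, Matrix.det_mul, det_sq_of_form h]⟩, exp_form Z.2, by
    have h := exp_form (lorentzAlgebra.smul_mem (1 / 2) Z.2)
    change 0 < NormedSpace.exp (Z : Matrix (Fin 4) (Fin 4) ℝ) 0 0
    rw [exp_eq_sq]
    exact sq_time_pos h⟩

lemma lorMat_lorentzExp (Z : lorentzAlgebra) : lorMat (lorentzExp Z) = NormedSpace.exp Z.1 := rfl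

lemma lorMat_injective : Function.Injective lorMat := fun _ _ h =>
  Subtype.ext (Subtype.ext h)

lemma lorentzExp_zero : lorentzExp 0 = 1 :=
  lorMat_injective (by rw [lorMat_lorentzExp, lorMat_one]; exact NormedSpace.exp_zero)

lemma lorentzExp_add_smul (s t : ℝ) (Z : lorentzAlgebra) :
    lorentzExp ((s + t) • Z) = lorentzExp (s • Z) * lorentzExp (t • Z) := by
  apply lorMat_injective
  rw [lorMat_mul]
  simp only [lorMat_lorentzExp, Submodule.coe_smul, add_smul]
  exact Matrix.exp_add_of_commute _ _ (((Commute.refl _).smul_left _).smul_right _)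

lemma lorentzExp_neg (Z : lorentzAlgebra) : lorentzExp (-Z) = (lorentzExp Z)⁻¹ := by
  have := lorentzExp_add_smul (-1) 1 Z
  rw [neg_add_cancel, zero_smul, lorentzExp_zero, neg_one_smul ℝ Z, one_smul] at this
  exact (inv_eq_of_mul_eq_one_left this.symm).symm

lemma lorMat_mul_inv (Λ : RestrictedLorentz) : lorMat Λ * lorMat Λ⁻¹ = 1 := by
  rw [← lorMat_mul, mul_inv_cancel, lorMat_one]

lemma lorMat_inv_mul (Λ : RestrictedLorentz) : lorMat Λ⁻¹ * lorMat Λ = 1 := by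
  rw [← lorMat_mul, inv_mul_cancel, lorMat_one]

lemma lorMat_inv (Λ : RestrictedLorentz) : lorMat Λ⁻¹ = (lorMat Λ)⁻¹ :=
  (Matrix.inv_eq_right_inv (lorMat_mul_inv Λ)).symm

/-- Projection of the `4 × 4` matrices onto the Lorentz algebra. -/
def projAlgebra : Matrix (Fin 4) (Fin 4) ℝ →ₗ[ℝ] lorentzAlgebra where
  toFun Z := ⟨(1 / 2 : ℝ) • (Z - minkowski * Zᵀ * minkowski), by
    have hmt : minkowskiᵀ = minkowski := by simp [minkowski]
    rw [mem_lorentzAlgebra]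
    simp only [Matrix.transpose_smul, Matrix.transpose_sub, Matrix.transpose_mul,
      Matrix.transpose_transpose, hmt, smul_mul_assoc, mul_smul_comm, ← smul_add, mul_sub,
      sub_mul, Matrix.mul_assoc, minkowski_sq, Matrix.mul_one]
    simp only [← Matrix.mul_assoc, minkowski_sq, Matrix.one_mul]
    simp⟩
  map_add' A B := by
    apply Subtype.ext
    simp only [Matrix.transpose_add, mul_add, add_mul, Submodule.coe_add, ← smul_add]
    congr 1
    abel
  map_smul' c A := by
    apply Subtype.ext
    simp only [Matrix.transpose_smul, smul_mul_assoc, mul_smul_comm, Submodule.coe_smul,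
      RingHom.id_apply, ← smul_sub]
    rw [smul_comm]

/-- The projection is a linear retraction. Through it, matrix expressions define elements of the
subtype and matrix derivatives become derivatives in the algebra. -/
lemma projAlgebra_coe (Z : lorentzAlgebra) : projAlgebra Z = Z := by
  apply Subtype.ext
  change (1 / 2 : ℝ) • (Z.1 - minkowski * Z.1ᵀ * minkowski) = Z.1
  rw [lorentzAlgebra_conj Z.2]
  have : minkowski * (minkowski * -Z.1 * minkowski) * minkowski = -Z.1 := by
    simp only [Matrix.mul_assoc, minkowski_sq, Matrix.mul_one]
    simp only [← Matrix.mul_assoc, minkowski_sq, Matrix.one_mul]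
  rw [this, sub_neg_eq_add, ← two_smul ℝ, smul_smul]
  norm_num

/-- The adjoint action of the Lorentz group on its Lie algebra. -/
def adjoint (Λ : RestrictedLorentz) (Z : lorentzAlgebra) : lorentzAlgebra :=
  ⟨lorMat Λ * Z.1 * lorMat Λ⁻¹, by
    have hi : minkowski * lorMat Λ = (lorMat Λ⁻¹)ᵀ * minkowski := by
      calc minkowski * lorMat Λ = ((lorMat Λ⁻¹)ᵀ * (lorMat Λ)ᵀ) * (minkowski * lorMat Λ) := by
            rw [← Matrix.transpose_mul, lorMat_mul_inv, Matrix.transpose_one, Matrix.one_mul]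
        _ = (lorMat Λ⁻¹)ᵀ * ((lorMat Λ)ᵀ * minkowski * lorMat Λ) := by
            simp only [Matrix.mul_assoc]
        _ = _ := by rw [lorMat_form]
    have hi' : (lorMat Λ)ᵀ * minkowski = minkowski * lorMat Λ⁻¹ := by
      calc (lorMat Λ)ᵀ * minkowski = ((lorMat Λ)ᵀ * minkowski) * (lorMat Λ * lorMat Λ⁻¹) := by
            rw [lorMat_mul_inv, Matrix.mul_one]
        _ = ((lorMat Λ)ᵀ * minkowski * lorMat Λ) * lorMat Λ⁻¹ := by
            simp only [Matrix.mul_assoc]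
        _ = _ := by rw [lorMat_form]
    rw [mem_lorentzAlgebra]
    calc _ = (lorMat Λ⁻¹)ᵀ * Z.1ᵀ * ((lorMat Λ)ᵀ * minkowski) +
          (minkowski * lorMat Λ) * Z.1 * lorMat Λ⁻¹ := by
          simp only [Matrix.transpose_mul, Matrix.mul_assoc]
      _ = (lorMat Λ⁻¹)ᵀ * (Z.1ᵀ * minkowski + minkowski * Z.1) * lorMat Λ⁻¹ := by
          rw [hi, hi']
          simp only [Matrix.mul_assoc, mul_add, add_mul]
      _ = 0 := by rw [mem_lorentzAlgebra.mp Z.2]; simp⟩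

lemma adjoint_smul (Λ : RestrictedLorentz) (t : ℝ) (Z : lorentzAlgebra) :
    adjoint Λ (t • Z) = t • adjoint Λ Z := by
  apply Subtype.ext
  simp [adjoint]

lemma lorentzExp_adjoint (Λ : RestrictedLorentz) (Z : lorentzAlgebra) :
    lorentzExp (adjoint Λ Z) * Λ = Λ * lorentzExp Z := by
  rw [← eq_mul_inv_iff_mul_eq]
  apply lorMat_injective
  rw [lorMat_lorentzExp, lorMat_mul, lorMat_mul, lorMat_lorentzExp]
  have hu : IsUnit (lorMat Λ) :=
    ⟨⟨lorMat Λ, lorMat Λ⁻¹, lorMat_mul_inv Λ, lorMat_inv_mul Λ⟩, rfl⟩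
  have := Matrix.exp_conj (lorMat Λ) Z.1 hu
  simp only [adjoint]
  rw [lorMat_inv]
  exact this

/-- The commutator of two elements of the Lorentz algebra. -/
def bracket (A B : lorentzAlgebra) : lorentzAlgebra :=
  projAlgebra (A.1 * B.1 - B.1 * A.1)

/-- Product rule for exp(sA) B exp(-sA), followed by the projection, which is the identity on these
values. -/
lemma hasDerivAt_adjoint (A B : lorentzAlgebra) :
    HasDerivAt (fun s : ℝ => adjoint (lorentzExp (s • A)) B) (bracket A B) 0 := by
  have h1 : HasDerivAt (fun s : ℝ => NormedSpace.exp (s • A.1)) A.1 0 := by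
    exact (hasDerivAt_exp_smul_const (𝕂 := ℝ) A.1 0).congr_deriv
      (by rw [zero_smul, NormedSpace.exp_zero, one_mul])
  have h2 : HasDerivAt (fun s : ℝ => NormedSpace.exp (s • (-A.1))) (-A.1) 0 := by
    exact (hasDerivAt_exp_smul_const (𝕂 := ℝ) (-A.1) 0).congr_deriv
      (by rw [zero_smul, NormedSpace.exp_zero, one_mul])
  have h3 := (h1.mul_const B.1).mul h2
  have h4 := (LinearMap.toContinuousLinearMap projAlgebra).hasFDerivAt.comp_hasDerivAt 0 h3
  have h5 : (A.1 * B.1 * NormedSpace.exp ((0 : ℝ) • -A.1) +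
      NormedSpace.exp ((0 : ℝ) • A.1) * B.1 * -A.1) = A.1 * B.1 - B.1 * A.1 := by
    simp [NormedSpace.exp_zero, sub_eq_add_neg]
  rw [h5] at h4
  refine h4.congr_of_eventuallyEq (Filter.Eventually.of_forall fun s => ?_)
  change adjoint (lorentzExp (s • A)) B =
    projAlgebra (NormedSpace.exp (s • A.1) * B.1 * NormedSpace.exp (s • (-A.1)))
  rw [← projAlgebra_coe (adjoint (lorentzExp (s • A)) B)]
  congr 1
  change lorMat _ * B.1 * lorMat _ = _
  rw [← lorentzExp_neg, lorMat_lorentzExp, lorMat_lorentzExp]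
  simp

lemma contDiff_lorentzExp (i j : Fin 4) :
    ContDiff ℝ ∞ fun Z : lorentzAlgebra => lorMat (lorentzExp Z) i j := by
  have h1 : ContDiff ℝ ∞ (NormedSpace.exp : Matrix (Fin 4) (Fin 4) ℝ → _) :=
    contDiff_iff_contDiffAt.mpr fun x => (NormedSpace.exp_analytic (𝕂 := ℝ) x).contDiffAt
  have h2 : ContDiff ℝ ∞ fun Z : lorentzAlgebra => NormedSpace.exp Z.1 :=
    h1.comp lorentzAlgebra.subtypeL.contDiff
  exact (LinearMap.toContinuousLinearMap
    (Matrix.entryLinearMap ℝ ℝ i j)).contDiff.comp h2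

/-- Generator of the rotations about the `a`-th axis. -/
def rotGen (a : Fin 3) : lorentzAlgebra := projAlgebra (match a with
  | 0 => !![0, 0, 0, 0; 0, 0, 0, 0; 0, 0, 0, -1; 0, 0, 1, 0]
  | 1 => !![0, 0, 0, 0; 0, 0, 0, 1; 0, 0, 0, 0; 0, -1, 0, 0]
  | 2 => !![0, 0, 0, 0; 0, 0, -1, 0; 0, 1, 0, 0; 0, 0, 0, 0])

/-- Generator of the boosts along the `a`-th axis. -/
def boostGen (a : Fin 3) : lorentzAlgebra := projAlgebra (match a with
  | 0 => !![0, 1, 0, 0; 1, 0, 0, 0; 0, 0, 0, 0; 0, 0, 0, 0]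
  | 1 => !![0, 0, 1, 0; 0, 0, 0, 0; 1, 0, 0, 0; 0, 0, 0, 0]
  | 2 => !![0, 0, 0, 1; 0, 0, 0, 0; 0, 0, 0, 0; 1, 0, 0, 0])

lemma coe_projAlgebra (Z : Matrix (Fin 4) (Fin 4) ℝ) :
    (projAlgebra Z).1 = (1 / 2 : ℝ) • (Z - minkowski * Zᵀ * minkowski) := rfl

lemma rotGen_coe (a : Fin 3) : (rotGen a).1 = match a with
  | 0 => !![0, 0, 0, 0; 0, 0, 0, 0; 0, 0, 0, -1; 0, 0, 1, 0]
  | 1 => !![0, 0, 0, 0; 0, 0, 0, 1; 0, 0, 0, 0; 0, -1, 0, 0]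
  | 2 => !![0, 0, 0, 0; 0, 0, -1, 0; 0, 1, 0, 0; 0, 0, 0, 0] := by
  fin_cases a <;> ext i j <;> fin_cases i <;> fin_cases j <;>
    simp [rotGen, coe_projAlgebra, minkowski, Matrix.mul_apply,
      Matrix.diagonal_apply] <;> norm_num

lemma boostGen_coe (a : Fin 3) : (boostGen a).1 = match a with
  | 0 => !![0, 1, 0, 0; 1, 0, 0, 0; 0, 0, 0, 0; 0, 0, 0, 0]
  | 1 => !![0, 0, 1, 0; 0, 0, 0, 0; 1, 0, 0, 0; 0, 0, 0, 0]
  | 2 => !![0, 0, 0, 1; 0, 0, 0, 0; 0, 0, 0, 0; 1, 0, 0, 0] := by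
  fin_cases a <;> ext i j <;> fin_cases i <;> fin_cases j <;>
    simp [boostGen, coe_projAlgebra, minkowski, Matrix.mul_apply,
      Matrix.diagonal_apply] <;> norm_num

lemma hasDerivAt_matrix {f : ℝ → Matrix (Fin 4) (Fin 4) ℝ} {f' : Matrix (Fin 4) (Fin 4) ℝ} {t : ℝ}
    (h : ∀ i j, HasDerivAt (fun s => f s i j) (f' i j) t) : HasDerivAt f f' t := by
  have key : ∀ A : Matrix (Fin 4) (Fin 4) ℝ,
      A = ∑ i, ∑ j, A i j • Matrix.single i j (1 : ℝ) := by
    intro A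
    conv_lhs => rw [Matrix.matrix_eq_sum_single A]
    simp
  rw [key f', funext fun s => key (f s)]
  exact HasDerivAt.fun_sum fun i _ => HasDerivAt.fun_sum fun j _ => (h i j).smul_const _

/-- Uniqueness for a linear equation: exp(-tZ) f(t) has derivative zero. It identifies one-parameter
groups with explicit matrices. -/
lemma exp_smul_eq_of_ode {f : ℝ → Matrix (Fin 4) (Fin 4) ℝ} {Z : Matrix (Fin 4) (Fin 4) ℝ}
    (h0 : f 0 = 1) (h : ∀ t, HasDerivAt f (Z * f t) t) (t : ℝ) :
    NormedSpace.exp (t • Z) = f t := by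
  have h1 : ∀ t, HasDerivAt (fun s : ℝ => NormedSpace.exp (s • (-Z)) * f s) 0 t := by
    intro t
    have := (hasDerivAt_exp_smul_const (𝕂 := ℝ) (-Z) t).mul (h t)
    refine this.congr_deriv ?_
    rw [mul_neg, neg_mul, mul_assoc, neg_add_cancel]
  have h2 := is_const_of_deriv_eq_zero (fun t => (h1 t).differentiableAt)
    (fun t => (h1 t).deriv) t 0
  simp only [zero_smul, NormedSpace.exp_zero, h0, mul_one] at h2
  have h3 : NormedSpace.exp (t • Z) * NormedSpace.exp (t • (-Z)) = 1 := by
    rw [smul_neg, ← Matrix.exp_add_of_commute _ _ (Commute.neg_right (Commute.refl (t • Z))), add_neg_cancel,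
      NormedSpace.exp_zero]
  calc NormedSpace.exp (t • Z) = NormedSpace.exp (t • Z) * (NormedSpace.exp (t • (-Z)) * f t) := by
        rw [h2, mul_one]
    _ = f t := by rw [← mul_assoc, h3, one_mul]

lemma lorentzExp_rotGen (a : Fin 3) (t : ℝ) : lorentzExp (t • rotGen a) = rotation a t := by
  apply lorMat_injective
  change NormedSpace.exp (t • (rotGen a).1) = rotationMatrix a t
  refine exp_smul_eq_of_ode (f := rotationMatrix a) ?_ (fun s => hasDerivAt_matrix fun i j => ?_) t
  · ext i j
    fin_cases a <;> fin_cases i <;> fin_cases j <;> simp [rotationMatrix]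
  · rw [rotGen_coe]
    have h1 := Real.hasDerivAt_cos s
    have h2 := Real.hasDerivAt_sin s
    fin_cases a <;> fin_cases i <;> fin_cases j <;>
      simp [rotationMatrix, Matrix.mul_apply, Fin.sum_univ_succ, hasDerivAt_const] <;>
      first | assumption | exact h2.neg

lemma lorentzExp_boostGen (a : Fin 3) (t : ℝ) : lorentzExp (t • boostGen a) = boost a t := by
  apply lorMat_injective
  change NormedSpace.exp (t • (boostGen a).1) = boostMatrix a t
  refine exp_smul_eq_of_ode (f := boostMatrix a) ?_ (fun s => hasDerivAt_matrix fun i j => ?_) t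
  · ext i j
    fin_cases a <;> fin_cases i <;> fin_cases j <;> simp [boostMatrix]
  · rw [boostGen_coe]
    have h1 := Real.hasDerivAt_cosh s
    have h2 := Real.hasDerivAt_sinh s
    fin_cases a <;> fin_cases i <;> fin_cases j <;>
      simp [boostMatrix, Matrix.mul_apply, Fin.sum_univ_succ, hasDerivAt_const] <;>
      first | assumption

lemma bracket_eq {A B C : lorentzAlgebra} (h : A.1 * B.1 - B.1 * A.1 = C.1) :
    bracket A B = C := by
  rw [bracket, h, projAlgebra_coe]

end BoostCurvature

end

noncomputable section

namespace BoostCurvature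

/-! ### Smoothness of the action on sections -/

/-- Makes the inverse linear in the matrix entries, hence smooth along smooth families. -/
lemma lorMat_inv_eq (Λ : RestrictedLorentz) :
    lorMat Λ⁻¹ = minkowski * (lorMat Λ)ᵀ * minkowski := by
  have hl : (minkowski * (lorMat Λ)ᵀ * minkowski) * lorMat Λ = 1 := by
    calc _ = minkowski * ((lorMat Λ)ᵀ * minkowski * lorMat Λ) := by simp only [Matrix.mul_assoc]
      _ = 1 := by rw [lorMat_form, minkowski_sq]
  exact (left_inv_eq_right_inv hl (lorMat_mul_inv Λ)).symm

lemma ofLorentz_mul (Λ Λ' : RestrictedLorentz) :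
    Poincare.ofLorentz (Λ * Λ') = Poincare.ofLorentz Λ * Poincare.ofLorentz Λ' := by
  refine Poincare.ext ?_ rfl
  change (0 : Fin 4 → ℝ) = 0 + lorMat Λ *ᵥ 0
  simp

lemma ofLorentz_one : Poincare.ofLorentz 1 = 1 := rfl

lemma ofLorentz_inv (Λ : RestrictedLorentz) :
    Poincare.ofLorentz Λ⁻¹ = (Poincare.ofLorentz Λ)⁻¹ := by
  rw [eq_inv_iff_mul_eq_one, ← ofLorentz_mul, inv_mul_cancel, ofLorentz_one]

lemma coe_ofLorentz_smul {m : ℝ} (Λ : RestrictedLorentz) (k : momentumSpace m) :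
    ((Poincare.ofLorentz Λ • k : momentumSpace m) : Vec3) =
      spatial (lorMat Λ *ᵥ fourMomentum m k) := rfl

lemma contDiff_spatial {V : Type*} [NormedAddCommGroup V] [NormedSpace ℝ V] {f : V → Fin 4 → ℝ}
    (hf : ∀ i, ContDiff ℝ ∞ fun x => f x i) : ContDiff ℝ ∞ fun x => spatial (f x) :=
  contDiff_euclidean.mpr fun i => hf i.succ

lemma energy_arg_pos {m : ℝ} (k : momentumSpace m) : 0 < m ^ 2 + ‖(k : Vec3)‖ ^ 2 :=
  Real.sqrt_pos.mp (energy_pos k)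

lemma contDiff_fourMomentum {m : ℝ} {V : Type*} [NormedAddCommGroup V] [NormedSpace ℝ V]
    {c : V → momentumSpace m} (hc : ContDiff ℝ ∞ fun x => (c x : Vec3)) (i : Fin 4) :
    ContDiff ℝ ∞ fun x => fourMomentum m (c x) i := by
  refine Fin.cases ?_ (fun j => ?_) i
  · change ContDiff ℝ ∞ fun x => √(m ^ 2 + ‖(c x : Vec3)‖ ^ 2)
    exact (contDiff_const.add (hc.norm_sq ℝ)).sqrt fun x => (energy_arg_pos (c x)).ne'
  · exact contDiff_euclidean.mp hc j

lemma contDiff_mulVec {V : Type*} [NormedAddCommGroup V] [NormedSpace ℝ V]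
    {A : V → Matrix (Fin 4) (Fin 4) ℝ} {p : V → Fin 4 → ℝ}
    (hA : ∀ i j, ContDiff ℝ ∞ fun x => A x i j) (hp : ∀ i, ContDiff ℝ ∞ fun x => p x i)
    (i : Fin 4) : ContDiff ℝ ∞ fun x => (A x *ᵥ p x) i := by
  simp only [Matrix.mulVec, dotProduct]
  exact ContDiff.sum fun j _ => (hA i j).mul (hp j)

lemma contDiff_lorMat_inv {V : Type*} [NormedAddCommGroup V] [NormedSpace ℝ V]
    {γ : V → RestrictedLorentz} (hγ : ∀ i j, ContDiff ℝ ∞ fun x => lorMat (γ x) i j)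
    (i j : Fin 4) : ContDiff ℝ ∞ fun x => lorMat (γ x)⁻¹ i j := by
  simp only [lorMat_inv_eq, minkowski, Matrix.mul_diagonal, Matrix.diagonal_mul,
    Matrix.transpose_apply]
  exact (contDiff_const.mul (hγ j i)).mul contDiff_const

lemma contDiff_smul {m : ℝ} {V : Type*} [NormedAddCommGroup V] [NormedSpace ℝ V]
    {γ : V → RestrictedLorentz} (hγ : ∀ i j, ContDiff ℝ ∞ fun x => lorMat (γ x) i j)
    {c : V → momentumSpace m} (hc : ContDiff ℝ ∞ fun x => (c x : Vec3)) :
    ContDiff ℝ ∞ fun x => ((Poincare.ofLorentz (γ x) • c x : momentumSpace m) : Vec3) :=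
  contDiff_spatial (contDiff_mulVec hγ (contDiff_fourMomentum hc))

lemma contDiff_lorMat_mul {V : Type*} [NormedAddCommGroup V] [NormedSpace ℝ V]
    {γ δ : V → RestrictedLorentz} (hγ : ∀ i j, ContDiff ℝ ∞ fun x => lorMat (γ x) i j)
    (hδ : ∀ i j, ContDiff ℝ ∞ fun x => lorMat (δ x) i j) (i j : Fin 4) :
    ContDiff ℝ ∞ fun x => lorMat (γ x * δ x) i j := by
  simp only [lorMat_mul, Matrix.mul_apply]
  exact ContDiff.sum fun l _ => (hγ i l).mul (hδ l j)

section Bundles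

variable {m : ℝ} {F : Type*} [NormedAddCommGroup F] [NormedSpace ℂ F]
  {E : momentumSpace m → Type*} [TopologicalSpace (TotalSpace F E)]
  [∀ k, NormedAddCommGroup (E k)] [∀ k, InnerProductSpace ℂ (E k)]
  [FiberBundle F E]

namespace BundleRep

variable (ρ : BundleRep F E)

/-- Frees the base point g⁻¹k from its syntactic form, so that fibre maps can be compared without
casts. -/
lemma sectionAct_apply_of_eq (g : Poincare) (ψ : ∀ k, E k) {k k' : momentumSpace m}
    (h : g • k' = k) : ρ.sectionAct g ψ k = ρ.act g h (ψ k') := by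
  obtain rfl : g⁻¹ • k = k' := by rw [← h, inv_smul_smul]
  rfl

lemma sectionAct_mul (g h : Poincare) (ψ : ∀ k, E k) :
    ρ.sectionAct (g * h) ψ = ρ.sectionAct g (ρ.sectionAct h ψ) := by
  funext k
  rw [ρ.sectionAct_apply_of_eq (g * h) ψ (k' := h⁻¹ • g⁻¹ • k)
      (by rw [mul_smul, smul_inv_smul, smul_inv_smul]),
    ρ.act_mul g h (smul_inv_smul _ _) (smul_inv_smul _ _)]
  rfl

lemma sectionAct_one (ψ : ∀ k, E k) : ρ.sectionAct 1 ψ = ψ := by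
  funext k
  rw [ρ.sectionAct_apply_of_eq 1 ψ (one_smul _ k), ρ.act_one]

lemma norm_act (g : Poincare) {k k' : momentumSpace m} (h : g • k = k') (v : E k) :
    ‖ρ.act g h v‖ = ‖v‖ := by
  rw [@norm_eq_sqrt_re_inner ℂ, @norm_eq_sqrt_re_inner ℂ, ρ.inner_act]

/-- The fibre map `Σ_g` as a real continuous linear map. -/
def actL (g : Poincare) {k k' : momentumSpace m} (h : g • k = k') : E k →L[ℝ] E k' :=
  ((ρ.act g h).restrictScalars ℝ).mkContinuous 1 fun v => by
    simp [ρ.norm_act g h v]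

end BundleRep

/-- The points g g⁻¹ k and k are equal only propositionally; in the total space the two vectors over
them are honestly equal. -/
lemma totalSpace_mk_act (ρ : BundleRep F E) (g : Poincare) (ψ : ∀ k, E k) (k : momentumSpace m) :
    (TotalSpace.mk' F (g • g⁻¹ • k) (ρ.act g rfl (ψ (g⁻¹ • k))) : TotalSpace F E) =
      TotalSpace.mk' F k (ρ.sectionAct g ψ k) := by
  have : ∀ k' (h : g • g⁻¹ • k = k'),
      (TotalSpace.mk' F (g • g⁻¹ • k) (ρ.act g rfl (ψ (g⁻¹ • k))) : TotalSpace F E) =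
      TotalSpace.mk' F k' (ρ.act g h (ψ (g⁻¹ • k))) := by
    rintro _ rfl
    rfl
  exact this k (smul_inv_smul g k)

lemma contMDiff_sectionAct (ρ : BundleRep F E) {n : ℕ}
    {γ : EuclideanSpace ℝ (Fin n) → RestrictedLorentz}
    (hγ : ∀ i j, ContDiff ℝ ∞ fun x => lorMat (γ x) i j)
    {c : EuclideanSpace ℝ (Fin n) → momentumSpace m} (hc : ContDiff ℝ ∞ fun x => (c x : Vec3))
    {ψ : ∀ k, E k} (hψ : IsSmoothSection F ψ) :
    ContMDiff 𝓘(ℝ, EuclideanSpace ℝ (Fin n)) (𝓘(ℝ, Vec3).prod 𝓘(ℝ, F)) ∞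
      (fun x => (TotalSpace.mk' F (c x) (ρ.sectionAct (Poincare.ofLorentz (γ x)) ψ (c x)) :
        TotalSpace F E)) := by
  have h1 := ρ.smooth_act n (fun x => Poincare.ofLorentz (γ x)) ⟨fun i => contDiff_const, hγ⟩
  have h2 : ContMDiff 𝓘(ℝ, EuclideanSpace ℝ (Fin n)) 𝓘(ℝ, Vec3) ∞
      (fun x => (Poincare.ofLorentz (γ x))⁻¹ • c x) := by
    rw [← ContMDiff.subtypeVal_comp_iff, contMDiff_iff_contDiff]
    exact contDiff_smul (contDiff_lorMat_inv hγ) hc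
  have h3 := h1.comp (contMDiff_id.prodMk (hψ.comp h2))
  refine h3.congr fun x => ?_
  exact (totalSpace_mk_act ρ _ ψ (c x)).symm

variable [VectorBundle ℝ F E]

/-- A trivialisation restricts to a continuous linear equivalence of the fibre with F, so smoothness
in the total space is smoothness in the normed space `E k`. -/
lemma contDiff_of_totalSpace {V : Type*} [NormedAddCommGroup V] [NormedSpace ℝ V]
    (k : momentumSpace m) {v : V → E k}
    (h : ContMDiff 𝓘(ℝ, V) (𝓘(ℝ, Vec3).prod 𝓘(ℝ, F)) ∞
      (fun x => (TotalSpace.mk' F k (v x) : TotalSpace F E))) : ContDiff ℝ ∞ v := by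
  let L := (trivializationAt F E k).continuousLinearEquivAt ℝ k (mem_baseSet_trivializationAt F E k)
  have h1 : ContDiff ℝ ∞ fun x => L (v x) := by
    rw [contDiff_iff_contDiffAt]
    intro x
    exact (contMDiffAt_totalSpace.mp (h x)).2.contDiffAt
  have h2 := L.symm.contDiff.comp h1
  simpa [Function.comp_def] using h2

lemma contDiff_sectionAct (ρ : BundleRep F E) {V : Type*} [NormedAddCommGroup V] [NormedSpace ℝ V]
    [FiniteDimensional ℝ V] {γ : V → RestrictedLorentz}
    (hγ : ∀ i j, ContDiff ℝ ∞ fun x => lorMat (γ x) i j)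
    {ψ : ∀ k, E k} (hψ : IsSmoothSection F ψ) (k : momentumSpace m) :
    ContDiff ℝ ∞ fun x => ρ.sectionAct (Poincare.ofLorentz (γ x)) ψ k := by
  -- Smoothness of the action is given only for families over ℝⁿ, so V is identified with a
  -- Euclidean space.
  have h1 := contMDiff_sectionAct ρ (γ := fun y => γ ((toEuclidean (E := V)).symm y))
    (fun i j => (hγ i j).comp (toEuclidean (E := V)).symm.contDiff)
    (c := fun _ => k) contDiff_const hψ
  have h2 := (contDiff_of_totalSpace k h1).comp (toEuclidean (E := V)).contDiff
  simpa [Function.comp_def] using h2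

end Bundles

end BoostCurvature

end

noncomputable section

namespace BoostCurvature

attribute [local instance] Matrix.linftyOpNormedRing Matrix.linftyOpNormedAlgebra

/-! ### Mixed partial derivatives -/

section MixedDerivatives

variable {V : Type*} [NormedAddCommGroup V] [NormedSpace ℝ V] {H : ℝ × ℝ → V}

lemma hasDerivAt_snd (hH : ContDiff ℝ ∞ H) (s t : ℝ) :
    HasDerivAt (fun t => H (s, t)) (fderiv ℝ H (s, t) (0, 1)) t :=
  (hH.differentiable (by simp) (s, t)).hasFDerivAt.comp_hasDerivAt t
    ((hasDerivAt_const t s).prodMk (hasDerivAt_id t))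

lemma hasDerivAt_fst (hH : ContDiff ℝ ∞ H) (s t : ℝ) :
    HasDerivAt (fun s => H (s, t)) (fderiv ℝ H (s, t) (1, 0)) s :=
  (hH.differentiable (by simp) (s, t)).hasFDerivAt.comp_hasDerivAt s
    ((hasDerivAt_id s).prodMk (hasDerivAt_const s t))

lemma contDiff_fderiv_apply (hH : ContDiff ℝ ∞ H) (v : ℝ × ℝ) :
    ContDiff ℝ ∞ fun x => fderiv ℝ H x v :=
  (hH.fderiv_right (m := ∞) (by simp)).clm_apply contDiff_const

lemma fderiv_fderiv_apply (hH : ContDiff ℝ ∞ H) (x v w : ℝ × ℝ) :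
    fderiv ℝ (fun y => fderiv ℝ H y v) x w = fderiv ℝ (fderiv ℝ H) x w v := by
  have h := ((hH.fderiv_right (m := ∞) (by simp)).differentiable (by simp) x).hasFDerivAt
  rw [(h.clm_apply (hasFDerivAt_const v x)).fderiv]
  simp

/-- The mixed partial derivatives of a smooth function of two real variables agree. -/
lemma deriv_deriv_comm (hH : ContDiff ℝ ∞ H) :
    deriv (fun s => deriv (fun t => H (s, t)) 0) 0 =
      deriv (fun t => deriv (fun s => H (s, t)) 0) 0 := by
  simp only [fun s => (hasDerivAt_snd hH s 0).deriv, fun t => (hasDerivAt_fst hH 0 t).deriv]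
  rw [(hasDerivAt_fst (contDiff_fderiv_apply hH (0, 1)) 0 0).deriv,
    (hasDerivAt_snd (contDiff_fderiv_apply hH (1, 0)) 0 0).deriv,
    fderiv_fderiv_apply hH, fderiv_fderiv_apply hH]
  exact (hH.contDiffAt.isSymmSndFDerivAt (by simpa using ENat.LEInfty.out)).eq _ _

lemma differentiableAt_deriv_snd (hH : ContDiff ℝ ∞ H) (s : ℝ) :
    DifferentiableAt ℝ (fun s => deriv (fun t => H (s, t)) 0) s := by
  simp only [fun s => (hasDerivAt_snd hH s 0).deriv]
  exact (hasDerivAt_fst (contDiff_fderiv_apply hH (0, 1)) s 0).differentiableAt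

lemma hasDerivAt_comp_smul {G : Type*} [NormedAddCommGroup G] [NormedSpace ℝ G] {f : G → V}
    (hf : ContDiff ℝ ∞ f) (Z : G) : HasDerivAt (fun t : ℝ => f (t • Z)) (fderiv ℝ f 0 Z) 0 := by
  have h1 : HasDerivAt (fun t : ℝ => t • Z) Z 0 := by
    simpa using (hasDerivAt_id (0 : ℝ)).smul_const Z
  have h2 := (hf.differentiable (by simp) 0).hasFDerivAt
  refine HasFDerivAt.comp_hasDerivAt (l := f) 0 ?_ h1
  rwa [zero_smul]

/-- The second order part of the product rule which turns the adjoint action into a commutator. -/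
lemma commutator_deriv {G : Type*} [NormedAddCommGroup G] [NormedSpace ℝ G] {W : G × ℝ → V}
    (hW : ContDiff ℝ ∞ W) {b : ℝ → G} {β : G} (hb : HasDerivAt b β 0) :
    deriv (fun s => deriv (fun t : ℝ => W (t • b s, s)) 0) 0 -
      deriv (fun t : ℝ => deriv (fun s => W (t • b 0, s)) 0) 0 =
      deriv (fun t : ℝ => W (t • β, 0)) 0 := by
  -- The partial derivative of W in the direction of G at the point (0, s), linear in that
  -- direction.
  let c : ℝ → G →L[ℝ] V := fun s => (fderiv ℝ W (0, s)).comp (ContinuousLinearMap.inl ℝ G ℝ)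
  have hc1 : ∀ s Z, HasDerivAt (fun t : ℝ => W (t • Z, s)) (c s Z) 0 := by
    intro s Z
    have h1 : HasDerivAt (fun t : ℝ => (t • Z, s)) (Z, (0 : ℝ)) 0 := by
      have := (hasDerivAt_id (0 : ℝ)).smul_const Z
      rw [one_smul] at this
      exact this.prodMk (hasDerivAt_const 0 s)
    have h2 := (hW.differentiable (by simp) (0, s)).hasFDerivAt
    refine HasFDerivAt.comp_hasDerivAt (l := W) 0 ?_ h1
    rwa [zero_smul]
  have hcd : HasDerivAt c (deriv c 0) 0 := by
    have h1 : ContDiff ℝ ∞ fun s : ℝ => fderiv ℝ W (0, s) :=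
      (hW.fderiv_right (m := ∞) (by simp)).comp (contDiff_const.prodMk contDiff_id)
    exact ((h1.clm_comp contDiff_const).differentiable (by simp) 0).hasDerivAt
  have h1 : HasDerivAt (fun s => c s (b s)) (deriv c 0 (b 0) + c 0 β) 0 := hcd.clm_apply hb
  have h2 : HasDerivAt (fun s => c s (b 0)) (deriv c 0 (b 0)) 0 := by
    simpa using hcd.clm_apply (hasDerivAt_const 0 (b 0))
  have h3 : ContDiff ℝ ∞ fun q : ℝ × ℝ => W (q.1 • b 0, q.2) :=
    hW.comp ((contDiff_fst.smul contDiff_const).prodMk contDiff_snd)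
  -- After the exchange both terms are s-derivatives, of c s (b s) and c s (b 0); they differ by c 0
  -- β.
  rw [deriv_deriv_comm h3]
  simp only [fun s Z => (hc1 s Z).deriv]
  rw [h1.deriv, h2.deriv, add_sub_cancel_left]

end MixedDerivatives

/-! ### The representation of the Lorentz algebra on sections -/

section Bundles

variable {m : ℝ} {F : Type*} [NormedAddCommGroup F] [NormedSpace ℂ F]
  {E : momentumSpace m → Type*} [TopologicalSpace (TotalSpace F E)]
  [∀ k, NormedAddCommGroup (E k)] [∀ k, InnerProductSpace ℂ (E k)]
  [FiberBundle F E]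

/-- The infinitesimal action of the Lorentz algebra on momenta. -/
def infMomentum {m : ℝ} (Z : lorentzAlgebra) (k : momentumSpace m) : Vec3 :=
  spatial (Z.1 *ᵥ fourMomentum m k)

/-- The spatial part as a linear map. -/
def spatialL : (Fin 4 → ℝ) →ₗ[ℝ] Vec3 where
  toFun := spatial
  map_add' _ _ := rfl
  map_smul' _ _ := rfl

lemma hasDerivAt_momentum (Z : lorentzAlgebra) (k : momentumSpace m) :
    HasDerivAt (fun t : ℝ => (((Poincare.ofLorentz (lorentzExp (t • Z)))⁻¹ • k :
      momentumSpace m) : Vec3)) (-infMomentum Z k) 0 := by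
  let L : Matrix (Fin 4) (Fin 4) ℝ →ₗ[ℝ] Vec3 :=
    spatialL ∘ₗ (LinearMap.flip (Matrix.mulVecBilin ℝ ℝ)) (fourMomentum m k)
  have h2 : HasDerivAt (fun s : ℝ => NormedSpace.exp (s • (-Z.1))) (-Z.1) 0 :=
    (hasDerivAt_exp_smul_const (𝕂 := ℝ) (-Z.1) 0).congr_deriv
      (by rw [zero_smul, NormedSpace.exp_zero, one_mul])
  have h3 := (LinearMap.toContinuousLinearMap L).hasFDerivAt.comp_hasDerivAt 0 h2
  have h4 : (LinearMap.toContinuousLinearMap L) (-Z.1) = -infMomentum Z k := by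
    rw [map_neg]
    rfl
  refine (h3.congr_deriv h4).congr_of_eventuallyEq (Filter.Eventually.of_forall fun s => ?_)
  change (((Poincare.ofLorentz (lorentzExp (s • Z)))⁻¹ • k : momentumSpace m) : Vec3) =
    spatial (NormedSpace.exp (s • (-Z.1)) *ᵥ fourMomentum m k)
  rw [← ofLorentz_inv, ← lorentzExp_neg, coe_ofLorentz_smul, lorMat_lorentzExp]
  simp

namespace BundleRep

variable (ρ : BundleRep F E)

/-- The infinitesimal action of the Lorentz algebra on sections. -/
def infAct (Z : lorentzAlgebra) (ψ : ∀ k, E k) : ∀ k, E k := fun k =>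
  deriv (fun t : ℝ => ρ.sectionAct (Poincare.ofLorentz (lorentzExp (t • Z))) ψ k) 0

/-- The infinitesimal action of `Z` on `χ` at `k` exists and equals `v`. -/
def HasInfAct (Z : lorentzAlgebra) (χ : ∀ k, E k) (k : momentumSpace m) (v : E k) : Prop :=
  HasDerivAt (fun t : ℝ => ρ.sectionAct (Poincare.ofLorentz (lorentzExp (t • Z))) χ k) v 0

lemma sectionAct_add (g : Poincare) (χ ξ : ∀ k, E k) (k : momentumSpace m) :
    ρ.sectionAct g (fun p => χ p + ξ p) k = ρ.sectionAct g χ k + ρ.sectionAct g ξ k :=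
  map_add _ _ _

lemma sectionAct_smul (g : Poincare) (f : momentumSpace m → ℂ) (χ : ∀ k, E k)
    (k : momentumSpace m) :
    ρ.sectionAct g (fun p => f p • χ p) k = f (g⁻¹ • k) • ρ.sectionAct g χ k :=
  map_smul _ _ _

variable {ρ}

lemma HasInfAct.infAct {Z : lorentzAlgebra} {χ : ∀ k, E k} {k : momentumSpace m} {v : E k}
    (h : ρ.HasInfAct Z χ k v) : ρ.infAct Z χ k = v := HasDerivAt.deriv h

lemma HasInfAct.add {Z : lorentzAlgebra} {χ ξ : ∀ k, E k} {k : momentumSpace m} {v w : E k}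
    (h : ρ.HasInfAct Z χ k v) (h' : ρ.HasInfAct Z ξ k w) :
    ρ.HasInfAct Z (fun p => χ p + ξ p) k (v + w) := by
  simp only [HasInfAct, sectionAct_add]
  exact HasDerivAt.add h h'

lemma HasInfAct.const_smul {Z : lorentzAlgebra} {χ : ∀ k, E k} {k : momentumSpace m} {v : E k}
    (h : ρ.HasInfAct Z χ k v) (c : ℂ) : ρ.HasInfAct Z (fun p => c • χ p) k (c • v) := by
  simp only [HasInfAct, ρ.sectionAct_smul _ (fun _ => c)]
  exact HasDerivAt.const_smul c h

/-- The Leibniz rule. -/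
lemma HasInfAct.smul {Z : lorentzAlgebra} {χ : ∀ k, E k} {k : momentumSpace m} {v : E k}
    (h : ρ.HasInfAct Z χ k v) {f : Vec3 → ℝ} {f' : Vec3 →L[ℝ] ℝ} (hf : HasFDerivAt f f' k) :
    ρ.HasInfAct Z (fun p => f p • χ p) k (-f' (infMomentum Z k) • χ k + f k • v) := by
  have h0 : (Poincare.ofLorentz (lorentzExp ((0 : ℝ) • Z)))⁻¹ • k = k := by
    rw [zero_smul, lorentzExp_zero, ofLorentz_one, inv_one, one_smul]
  have h1 : HasDerivAt (fun t : ℝ => f ((Poincare.ofLorentz (lorentzExp (t • Z)))⁻¹ • k :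
      momentumSpace m)) (f' (-infMomentum Z k)) 0 := by
    refine HasFDerivAt.comp_hasDerivAt (l := f) 0 ?_ (hasDerivAt_momentum Z k)
    rwa [h0]
  have h2 := HasDerivAt.smul h1 h
  rw [h0, zero_smul, lorentzExp_zero, ofLorentz_one, sectionAct_one, map_neg, add_comm] at h2
  refine HasDerivAt.congr_of_eventuallyEq h2 (Filter.Eventually.of_forall fun t => ?_)
  have := ρ.sectionAct_smul (Poincare.ofLorentz (lorentzExp (t • Z)))
    (fun p => ((f p : ℝ) : ℂ)) χ k
  simp only [Complex.coe_smul] at this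
  exact this

variable [VectorBundle ℝ F E]

lemma contDiff_sectionAct_lorentzExp (ρ : BundleRep F E) {ψ : ∀ k, E k}
    (hψ : IsSmoothSection F ψ) (k : momentumSpace m) :
    ContDiff ℝ ∞ fun Z => ρ.sectionAct (Poincare.ofLorentz (lorentzExp Z)) ψ k :=
  contDiff_sectionAct ρ contDiff_lorentzExp hψ k

/-- Expressing the derivative through the differential of the action at Z = 0 shows that it is
linear in Z. -/
lemma hasInfAct_of_smooth {Z : lorentzAlgebra} {ψ : ∀ k, E k} (hψ : IsSmoothSection F ψ)
    (k : momentumSpace m) : ρ.HasInfAct Z ψ k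
      (fderiv ℝ (fun Z => ρ.sectionAct (Poincare.ofLorentz (lorentzExp Z)) ψ k) 0 Z) :=
  hasDerivAt_comp_smul (contDiff_sectionAct_lorentzExp ρ hψ k) Z

lemma hasInfAct_infAct {Z : lorentzAlgebra} {ψ : ∀ k, E k} (hψ : IsSmoothSection F ψ)
    (k : momentumSpace m) : ρ.HasInfAct Z ψ k (ρ.infAct Z ψ k) := by
  rw [(hasInfAct_of_smooth hψ k).infAct]
  exact hasInfAct_of_smooth hψ k

lemma infAct_smul {ψ : ∀ k, E k} (hψ : IsSmoothSection F ψ) (c : ℝ) (A : lorentzAlgebra)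
    (k : momentumSpace m) : ρ.infAct (c • A) ψ k = c • ρ.infAct A ψ k := by
  simp only [(hasInfAct_of_smooth hψ k).infAct, map_smul]

lemma contDiff_sectionAct_pair (ρ : BundleRep F E) {ψ : ∀ k, E k} (hψ : IsSmoothSection F ψ)
    (A : lorentzAlgebra) (k : momentumSpace m) : ContDiff ℝ ∞ fun q : lorentzAlgebra × ℝ =>
      ρ.sectionAct (Poincare.ofLorentz (lorentzExp q.1 * lorentzExp (q.2 • A))) ψ k := by
  refine contDiff_sectionAct ρ (contDiff_lorMat_mul (fun i j => ?_) fun i j => ?_) hψ k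
  · exact (contDiff_lorentzExp i j).comp contDiff_fst
  · exact (contDiff_lorentzExp i j).comp (contDiff_snd.smul contDiff_const)

lemma contDiff_sectionAct_pair_real (ρ : BundleRep F E) {ψ : ∀ k, E k} (hψ : IsSmoothSection F ψ)
    (A B : lorentzAlgebra) (k : momentumSpace m) : ContDiff ℝ ∞ fun q : ℝ × ℝ =>
      ρ.sectionAct (Poincare.ofLorentz (lorentzExp (q.1 • B) * lorentzExp (q.2 • A))) ψ k :=
  (contDiff_sectionAct_pair ρ hψ A k).comp
    ((contDiff_fst.smul contDiff_const).prodMk contDiff_snd)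

/-- The map between two fixed fibres is continuous and linear, so it commutes with d/dt. -/
lemma sectionAct_infAct {ψ : ∀ k, E k} (hψ : IsSmoothSection F ψ) (Λ : RestrictedLorentz)
    (B : lorentzAlgebra) (k : momentumSpace m) :
    ρ.sectionAct (Poincare.ofLorentz Λ) (ρ.infAct B ψ) k =
      deriv (fun t : ℝ => ρ.sectionAct (Poincare.ofLorentz (Λ * lorentzExp (t • B))) ψ k) 0 := by
  have h := (ρ.actL (Poincare.ofLorentz Λ) (smul_inv_smul _ k)).hasFDerivAt.comp_hasDerivAt 0
    (hasInfAct_infAct (ρ := ρ) (Z := B) hψ ((Poincare.ofLorentz Λ)⁻¹ • k))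
  refine Eq.trans ?_ (h.deriv.symm.trans ?_)
  · rfl
  · congr 1
    funext t
    rw [ofLorentz_mul, sectionAct_mul]
    rfl

/-- Differentiability along one-parameter groups is all that iterated derivatives require;
smoothness of `ρ.infAct B ψ` as a section is never needed. -/
lemma hasInfAct_infAct_infAct {ψ : ∀ k, E k} (hψ : IsSmoothSection F ψ) (A B : lorentzAlgebra)
    (k : momentumSpace m) :
    ρ.HasInfAct A (ρ.infAct B ψ) k (ρ.infAct A (ρ.infAct B ψ) k) := by
  apply DifferentiableAt.hasDerivAt
  simp only [sectionAct_infAct hψ]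
  exact differentiableAt_deriv_snd (contDiff_sectionAct_pair_real ρ hψ B A k) 0

/-- The infinitesimal action is a representation of the Lorentz algebra. -/
theorem infAct_commutator {ψ : ∀ k, E k} (hψ : IsSmoothSection F ψ) (A B : lorentzAlgebra)
    (k : momentumSpace m) :
    ρ.infAct A (ρ.infAct B ψ) k - ρ.infAct B (ρ.infAct A ψ) k = ρ.infAct (bracket A B) ψ k := by
  have h0 : adjoint (lorentzExp ((0 : ℝ) • A)) B = B := by
    apply Subtype.ext
    simp [adjoint, lorentzExp_zero, lorMat_one]
  have h := commutator_deriv (contDiff_sectionAct_pair ρ hψ A k) (hasDerivAt_adjoint A B)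
  rw [h0] at h
  -- Here exp(sA) exp(tB) is rewritten with exp(sA) on the right, which puts both orders of
  -- differentiation in the form treated by `commutator_deriv`.
  have h1 : ρ.infAct A (ρ.infAct B ψ) k = deriv (fun s : ℝ => deriv (fun t : ℝ =>
      ρ.sectionAct (Poincare.ofLorentz (lorentzExp (t • adjoint (lorentzExp (s • A)) B) *
        lorentzExp (s • A))) ψ k) 0) 0 := by
    rw [BundleRep.infAct]
    simp only [sectionAct_infAct hψ, ← adjoint_smul, lorentzExp_adjoint]
  have h2 : ρ.infAct B (ρ.infAct A ψ) k = deriv (fun t : ℝ => deriv (fun s : ℝ =>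
      ρ.sectionAct (Poincare.ofLorentz (lorentzExp (t • B) * lorentzExp (s • A))) ψ k) 0) 0 := by
    rw [BundleRep.infAct]
    simp only [sectionAct_infAct hψ]
  rw [h1, h2, h, BundleRep.infAct]
  simp only [zero_smul, lorentzExp_zero, mul_one]

end BundleRep

end Bundles

end BoostCurvature

end

noncomputable section

namespace BoostCurvature

/-! ### Explicit form of the generators -/

lemma infMomentum_boostGen {m : ℝ} (a : Fin 3) (k : momentumSpace m) :
    infMomentum (boostGen a) k = energy m k • basisVec a := by
  ext i
  rw [infMomentum, boostGen_coe]
  fin_cases a <;> fin_cases i <;>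
    simp [spatial, fourMomentum, Matrix.mulVec, dotProduct, Fin.sum_univ_succ, basisVec]

lemma infMomentum_rotGen {m : ℝ} (a : Fin 3) (k : momentumSpace m) :
    infMomentum (rotGen a) k = cross (basisVec a) k := by
  ext i
  rw [infMomentum, rotGen_coe]
  fin_cases a <;> fin_cases i <;>
    simp [spatial, fourMomentum, Matrix.mulVec, dotProduct, Fin.sum_univ_succ, basisVec, cross,
      crossProduct]

/-- Boosts close up to rotations with a minus sign; this produces the rotational term of the
curvature. -/
lemma bracket_boost_boost : bracket (boostGen 0) (boostGen 1) = (-1 : ℝ) • rotGen 2 ∧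
    bracket (boostGen 0) (boostGen 2) = rotGen 1 ∧
    bracket (boostGen 1) (boostGen 2) = (-1 : ℝ) • rotGen 0 := by
  refine ⟨bracket_eq ?_, bracket_eq ?_, bracket_eq ?_⟩ <;>
    simp only [Submodule.coe_smul, rotGen_coe, boostGen_coe] <;> ext i j <;>
    fin_cases i <;> fin_cases j <;> simp

lemma bracket_rot_rot : bracket (rotGen 0) (rotGen 1) = rotGen 2 := by
  refine bracket_eq ?_
  simp only [rotGen_coe]
  ext i j
  fin_cases i <;> fin_cases j <;> simp

lemma bracket_rot_boost : bracket (rotGen 0) (boostGen 0) = (0 : ℝ) • boostGen 0 ∧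
    bracket (rotGen 0) (boostGen 1) = boostGen 2 ∧
    bracket (rotGen 0) (boostGen 2) = (-1 : ℝ) • boostGen 1 ∧
    bracket (rotGen 1) (boostGen 0) = (-1 : ℝ) • boostGen 2 ∧
    bracket (rotGen 1) (boostGen 1) = (0 : ℝ) • boostGen 0 ∧
    bracket (rotGen 1) (boostGen 2) = boostGen 0 := by
  refine ⟨bracket_eq ?_, bracket_eq ?_, bracket_eq ?_, bracket_eq ?_, bracket_eq ?_,
      bracket_eq ?_⟩ <;>
    simp only [Submodule.coe_smul, rotGen_coe, boostGen_coe] <;> ext i j <;>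
    fin_cases i <;> fin_cases j <;> simp

/-! ### Derivatives of the coefficient functions -/

lemma inner_eq (u v : Vec3) : inner ℝ u v = u 0 * v 0 + u 1 * v 1 + u 2 * v 2 := by
  simp [PiLp.inner_apply, Fin.sum_univ_three]
  ring

lemma hasFDerivAt_inv_energy {m : ℝ} (k : momentumSpace m) :
    HasFDerivAt (fun p : Vec3 => (energy m p)⁻¹)
      (-(energy m k)⁻¹ ^ 3 • innerSL ℝ (k : Vec3)) (k : Vec3) := by
  have h1 : HasFDerivAt (fun p : Vec3 => m ^ 2 + ‖p‖ ^ 2) (2 • innerSL ℝ (k : Vec3)) (k : Vec3) :=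
    (hasStrictFDerivAt_norm_sq (k : Vec3)).hasFDerivAt.const_add _
  have h2 : HasFDerivAt (fun p : Vec3 => energy m p) _ (k : Vec3) := h1.sqrt (energy_arg_pos k).ne'
  have h3 := (hasDerivAt_inv (energy_pos k).ne').comp_hasFDerivAt (k : Vec3) h2
  refine h3.congr_fderiv ?_
  ext v
  have := (energy_pos k).ne'
  change -(energy m k ^ 2)⁻¹ * (1 / (2 * energy m k) * (2 • (inner ℝ (k : Vec3) v))) =
    -(energy m k)⁻¹ ^ 3 * inner ℝ (k : Vec3) v
  simp only [nsmul_eq_mul]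
  push_cast
  field_simp

lemma hasFDerivAt_coord {Y : Vec3 → Vec3} {Y' : Vec3 →L[ℝ] Vec3} {k : Vec3}
    (hY : HasFDerivAt Y Y' k) (a : Fin 3) :
    HasFDerivAt (fun p => Y p a) ((EuclideanSpace.proj a : Vec3 →L[ℝ] ℝ).comp Y') k :=
  (EuclideanSpace.proj a : Vec3 →L[ℝ] ℝ).hasFDerivAt.comp k hY

/-! ### The boost connection in terms of the infinitesimal action -/

section Bundles

variable {m : ℝ} {F : Type*} [NormedAddCommGroup F] [NormedSpace ℂ F]
  {E : momentumSpace m → Type*} [TopologicalSpace (TotalSpace F E)]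
  [∀ k, NormedAddCommGroup (E k)] [∀ k, InnerProductSpace ℂ (E k)]
  [FiberBundle F E]

namespace BundleRep

variable {ρ : BundleRep F E}

lemma J_eq (a : Fin 3) (ψ : ∀ k, E k) (k : momentumSpace m) :
    ρ.J a ψ k = Complex.I • ρ.infAct (rotGen a) ψ k := by
  simp only [J, infAct, lorentzExp_rotGen]

lemma K_eq (a : Fin 3) (ψ : ∀ k, E k) (k : momentumSpace m) :
    ρ.K a ψ k = (-Complex.I) • ρ.infAct (boostGen a) ψ k := by
  simp only [K, infAct, lorentzExp_boostGen]

/-- The factors i cancel, leaving real coefficients, to which the Leibniz rule `HasInfAct.smul`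
applies. -/
lemma boostConnection_eq (Y : Vec3 → Vec3) (ψ : ∀ k, E k) : ρ.boostConnection Y ψ = fun k : momentumSpace m =>
    (-((energy m k)⁻¹ * Y k 0)) • ρ.infAct (boostGen 0) ψ k +
      (-((energy m k)⁻¹ * Y k 1)) • ρ.infAct (boostGen 1) ψ k +
      (-((energy m k)⁻¹ * Y k 2)) • ρ.infAct (boostGen 2) ψ k +
      (-(1 / 2 * (energy m k)⁻¹ ^ 2 * inner ℝ (Y k) (k : Vec3))) • ψ k := by
  funext k
  have h : (energy m k : ℂ) ≠ 0 := by exact_mod_cast (energy_pos k).ne'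
  simp only [boostConnection, dotK, Fin.sum_univ_three, K_eq, inner_eq, ← Complex.coe_smul]
  push_cast
  have hI : Complex.I ^ 2 = -1 := Complex.I_sq
  match_scalars
  all_goals
    field_simp
    try rw [hI]
    try ring

variable [VectorBundle ℝ F E]

/-- Leibniz rule term by term. Differentiability of Y at the single point k suffices, so the
derivative of `ρ.boostConnection Y ψ` there needs no smoothness of that section. -/
lemma hasInfAct_boostConnection {ψ : ∀ k, E k} (hψ : IsSmoothSection F ψ) (k : momentumSpace m)
    {Y : Vec3 → Vec3} {Y' : Vec3 →L[ℝ] Vec3} (hY : HasFDerivAt Y Y' k) (Z : lorentzAlgebra)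
    {q : Vec3} (hq : infMomentum Z k = q) :
    ρ.HasInfAct Z (ρ.boostConnection Y ψ) k
      (((energy m k)⁻¹ * Y' q 0 - (energy m k)⁻¹ ^ 3 * inner ℝ (k : Vec3) q * Y k 0) •
        ρ.infAct (boostGen 0) ψ k +
      ((energy m k)⁻¹ * Y' q 1 - (energy m k)⁻¹ ^ 3 * inner ℝ (k : Vec3) q * Y k 1) •
        ρ.infAct (boostGen 1) ψ k +
      ((energy m k)⁻¹ * Y' q 2 - (energy m k)⁻¹ ^ 3 * inner ℝ (k : Vec3) q * Y k 2) •
        ρ.infAct (boostGen 2) ψ k +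
      (1 / 2 * (energy m k)⁻¹ ^ 2 * (inner ℝ (Y' q) (k : Vec3) + inner ℝ (Y k) q) -
        (energy m k)⁻¹ ^ 4 * inner ℝ (k : Vec3) q * inner ℝ (Y k) (k : Vec3)) • ψ k -
      ((energy m k)⁻¹ * Y k 0) • ρ.infAct Z (ρ.infAct (boostGen 0) ψ) k -
      ((energy m k)⁻¹ * Y k 1) • ρ.infAct Z (ρ.infAct (boostGen 1) ψ) k -
      ((energy m k)⁻¹ * Y k 2) • ρ.infAct Z (ρ.infAct (boostGen 2) ψ) k -
      (1 / 2 * (energy m k)⁻¹ ^ 2 * inner ℝ (Y k) (k : Vec3)) • ρ.infAct Z ψ k) := by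
  have hw := hasFDerivAt_inv_energy k
  have hc : ∀ a, HasFDerivAt (fun p : Vec3 => -((energy m p)⁻¹ * Y p a)) _ (k : Vec3) :=
    fun a => (hw.mul (hasFDerivAt_coord hY a)).neg
  have hg : HasFDerivAt (fun p : Vec3 => -(1 / 2 * (energy m p)⁻¹ ^ 2 * inner ℝ (Y p) p)) _
      (k : Vec3) := ((((hw.pow 2).const_mul (1 / 2))).mul (hY.inner ℝ (hasFDerivAt_id _))).neg
  have h1 := fun a => (hasInfAct_infAct_infAct (ρ := ρ) hψ Z (boostGen a) k).smul (hc a)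
  have h2 := (((h1 0).add (h1 1)).add (h1 2)).add
    ((hasInfAct_infAct (ρ := ρ) (Z := Z) hψ k).smul hg)
  rw [boostConnection_eq]
  convert h2 using 1
  rw [hq]
  simp only [_root_.neg_apply, _root_.add_apply, _root_.smul_apply,
    ContinuousLinearMap.comp_apply, innerSL_apply_apply, fderivInnerCLM_apply,
    ContinuousLinearMap.prod_apply, PiLp.proj_apply, smul_eq_mul, ContinuousLinearMap.id_apply]
  match_scalars
  all_goals
    simp
    try ring

/-- For a boost the velocity of k is ω e_b, and its factor ω cancels one power of 1/ω. -/
lemma infAct_boostConnection {ψ : ∀ k, E k} (hψ : IsSmoothSection F ψ) (k : momentumSpace m)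
    {Y : Vec3 → Vec3} {Y' : Vec3 →L[ℝ] Vec3} (hY : HasFDerivAt Y Y' k) (b : Fin 3) :
    ρ.infAct (boostGen b) (ρ.boostConnection Y ψ) k =
      (Y' (basisVec b) 0 - (energy m k)⁻¹ ^ 2 * (k : Vec3) b * Y k 0) •
        ρ.infAct (boostGen 0) ψ k +
      (Y' (basisVec b) 1 - (energy m k)⁻¹ ^ 2 * (k : Vec3) b * Y k 1) •
        ρ.infAct (boostGen 1) ψ k +
      (Y' (basisVec b) 2 - (energy m k)⁻¹ ^ 2 * (k : Vec3) b * Y k 2) •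
        ρ.infAct (boostGen 2) ψ k +
      (1 / 2 * (energy m k)⁻¹ * (inner ℝ (Y' (basisVec b)) (k : Vec3) + Y k b) -
        (energy m k)⁻¹ ^ 3 * (k : Vec3) b * inner ℝ (Y k) (k : Vec3)) • ψ k -
      ((energy m k)⁻¹ * Y k 0) • ρ.infAct (boostGen b) (ρ.infAct (boostGen 0) ψ) k -
      ((energy m k)⁻¹ * Y k 1) • ρ.infAct (boostGen b) (ρ.infAct (boostGen 1) ψ) k -
      ((energy m k)⁻¹ * Y k 2) • ρ.infAct (boostGen b) (ρ.infAct (boostGen 2) ψ) k -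
      (1 / 2 * (energy m k)⁻¹ ^ 2 * inner ℝ (Y k) (k : Vec3)) • ρ.infAct (boostGen b) ψ k := by
  have hω := (energy_pos k).ne'
  have hk : ∀ v : Vec3, inner ℝ v (basisVec b) = v b := by
    intro v
    rw [inner_eq]
    fin_cases b <;> simp [basisVec]
  rw [(hasInfAct_boostConnection hψ k hY (boostGen b) (infMomentum_boostGen b k)).infAct]
  simp only [map_smul, inner_smul_left, inner_smul_right, hk, PiLp.smul_apply, smul_eq_mul]
  match_scalars
  all_goals
    simp
    try field_simp

end BundleRep

end Bundles

end BoostCurvature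

end

/-! ### The curvature formula -/

noncomputable section

namespace BoostCurvature

lemma vec3_eq_sum (v : Vec3) :
    v = v 0 • basisVec 0 + v 1 • basisVec 1 + v 2 • basisVec 2 := by
  ext i
  fin_cases i <;> simp [basisVec]

lemma cross_apply (u v : Vec3) : cross u v 0 = u 1 * v 2 - u 2 * v 1 ∧
    cross u v 1 = u 2 * v 0 - u 0 * v 2 ∧ cross u v 2 = u 0 * v 1 - u 1 * v 0 := by
  simp [cross, crossProduct]

section Bundles

variable {m : ℝ} {F : Type*} [NormedAddCommGroup F] [NormedSpace ℂ F]
  {E : momentumSpace m → Type*} [TopologicalSpace (TotalSpace F E)]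
  [∀ k, NormedAddCommGroup (E k)] [∀ k, InnerProductSpace ℂ (E k)]
  [FiberBundle F E]

namespace BundleRep

variable {ρ : BundleRep F E} [VectorBundle ℝ F E]

/-- Sorts products of two boosts by increasing index, so that the curvature becomes a linear
identity between independent terms. -/
lemma commutator_boost_boost {ψ : ∀ k, E k} (hψ : IsSmoothSection F ψ) (k : momentumSpace m) :
    ρ.infAct (boostGen 1) (ρ.infAct (boostGen 0) ψ) k =
      ρ.infAct (boostGen 0) (ρ.infAct (boostGen 1) ψ) k + ρ.infAct (rotGen 2) ψ k ∧
    ρ.infAct (boostGen 2) (ρ.infAct (boostGen 0) ψ) k =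
      ρ.infAct (boostGen 0) (ρ.infAct (boostGen 2) ψ) k - ρ.infAct (rotGen 1) ψ k ∧
    ρ.infAct (boostGen 2) (ρ.infAct (boostGen 1) ψ) k =
      ρ.infAct (boostGen 1) (ρ.infAct (boostGen 2) ψ) k + ρ.infAct (rotGen 0) ψ k := by
  have h01 := infAct_commutator (ρ := ρ) hψ (boostGen 0) (boostGen 1) k
  have h02 := infAct_commutator (ρ := ρ) hψ (boostGen 0) (boostGen 2) k
  have h12 := infAct_commutator (ρ := ρ) hψ (boostGen 1) (boostGen 2) k
  rw [bracket_boost_boost.1, infAct_smul hψ] at h01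
  rw [bracket_boost_boost.2.1] at h02
  rw [bracket_boost_boost.2.2, infAct_smul hψ] at h12
  refine ⟨?_, ?_, ?_⟩
  · rw [sub_eq_iff_eq_add.mp h01]
    module
  · rw [sub_eq_iff_eq_add.mp h02]
    module
  · rw [sub_eq_iff_eq_add.mp h12]
    module

/-- The curvature of the boost connection. -/
theorem curvature_boostConnection {ψ : ∀ k, E k} (hψ : IsSmoothSection F ψ) (k : momentumSpace m)
    {X Y : Vec3 → Vec3} (hX : DifferentiableAt ℝ X k) (hY : DifferentiableAt ℝ Y k) :
    curvature ρ.boostConnection X Y ψ k =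
      -(energy m k)⁻¹ ^ 2 • (cross (X k) (Y k) 0 • ρ.infAct (rotGen 0) ψ k +
        cross (X k) (Y k) 1 • ρ.infAct (rotGen 1) ψ k +
        cross (X k) (Y k) 2 • ρ.infAct (rotGen 2) ψ k) +
      ((energy m k)⁻¹ ^ 3 * inner ℝ (X k) (k : Vec3)) • (Y k 0 • ρ.infAct (boostGen 0) ψ k +
        Y k 1 • ρ.infAct (boostGen 1) ψ k + Y k 2 • ρ.infAct (boostGen 2) ψ k) -
      ((energy m k)⁻¹ ^ 3 * inner ℝ (Y k) (k : Vec3)) • (X k 0 • ρ.infAct (boostGen 0) ψ k +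
        X k 1 • ρ.infAct (boostGen 1) ψ k + X k 2 • ρ.infAct (boostGen 2) ψ k) := by
  obtain ⟨h01, h02, h12⟩ := commutator_boost_boost (ρ := ρ) hψ k
  obtain ⟨c0, c1, c2⟩ := cross_apply (X k) (Y k)
  have eX : ∀ Z : Vec3 → Vec3, fderiv ℝ Z k (X k) = X k 0 • fderiv ℝ Z k (basisVec 0) +
      X k 1 • fderiv ℝ Z k (basisVec 1) + X k 2 • fderiv ℝ Z k (basisVec 2) := fun Z => by
    conv_lhs => rw [vec3_eq_sum (X k)]
    simp only [map_add, map_smul]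
  have eY : ∀ Z : Vec3 → Vec3, fderiv ℝ Z k (Y k) = Y k 0 • fderiv ℝ Z k (basisVec 0) +
      Y k 1 • fderiv ℝ Z k (basisVec 1) + Y k 2 • fderiv ℝ Z k (basisVec 2) := fun Z => by
    conv_lhs => rw [vec3_eq_sum (Y k)]
    simp only [map_add, map_smul]
  rw [curvature, congrFun (boostConnection_eq X (ρ.boostConnection Y ψ)) k,
    congrFun (boostConnection_eq Y (ρ.boostConnection X ψ)) k,
    congrFun (boostConnection_eq (VectorField.lieBracket ℝ X Y) ψ) k]
  simp only [infAct_boostConnection hψ k hX.hasFDerivAt, infAct_boostConnection hψ k hY.hasFDerivAt,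
    congrFun (boostConnection_eq X ψ) k, congrFun (boostConnection_eq Y ψ) k,
    VectorField.lieBracket, eX, eY, h01, h02, h12, c0, c1, c2, inner_eq, PiLp.sub_apply,
    PiLp.add_apply, PiLp.smul_apply, smul_eq_mul]
  -- The identity is polynomial in 1/ω; the mass shell relation plays no further role.
  generalize (energy m k)⁻¹ = w
  module

end BundleRep

end Bundles

end BoostCurvature

end

/-! ### Spherical and rotational vector fields; commutators of the orbital and spin parts -/

noncomputable section

namespace BoostCurvature

lemma axisDist_sq (k : Vec3) : axisDist k ^ 2 = k 0 ^ 2 + k 1 ^ 2 :=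
  Real.sq_sqrt (by positivity)

lemma norm_ne_zero_of_axisDist {k : Vec3} (h : axisDist k ≠ 0) : ‖k‖ ≠ 0 := by
  contrapose! h
  rw [norm_eq_zero] at h
  simp [h, axisDist]

lemma differentiableAt_vec3_coord (k : Vec3) (a : Fin 3) :
    DifferentiableAt ℝ (fun p : Vec3 => p a) k :=
  (EuclideanSpace.proj a : Vec3 →L[ℝ] ℝ).differentiableAt

lemma differentiableAt_axisDist {k : Vec3} (h : axisDist k ≠ 0) :
    DifferentiableAt ℝ axisDist k := by
  refine DifferentiableAt.sqrt (f := fun k : Vec3 => k 0 ^ 2 + k 1 ^ 2) ?_ ?_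
  · exact ((differentiableAt_vec3_coord k 0).pow 2).add ((differentiableAt_vec3_coord k 1).pow 2)
  · rw [← axisDist_sq]
    exact pow_ne_zero 2 h

lemma differentiableAt_vec3_norm {k : Vec3} (h : ‖k‖ ≠ 0) :
    DifferentiableAt ℝ (fun p : Vec3 => ‖p‖) k :=
  differentiableAt_id.norm ℝ (norm_ne_zero_iff.mp h)

lemma differentiableAt_unitTheta {k : Vec3} (h : axisDist k ≠ 0) :
    DifferentiableAt ℝ unitTheta k := by
  have hn := norm_ne_zero_of_axisDist h
  have h1 := differentiableAt_axisDist h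
  have h2 := differentiableAt_vec3_norm hn
  have hc := differentiableAt_vec3_coord k
  refine differentiableAt_euclidean.mpr fun i => ?_
  fin_cases i
  · exact ((hc 2).mul (h2.fun_inv hn)).mul ((hc 0).mul (h1.fun_inv h))
  · exact ((hc 2).mul (h2.fun_inv hn)).mul ((hc 1).mul (h1.fun_inv h))
  · exact (h1.mul (h2.fun_inv hn)).neg

lemma differentiableAt_unitPhi {k : Vec3} (h : axisDist k ≠ 0) :
    DifferentiableAt ℝ unitPhi k := by
  have h1 := differentiableAt_axisDist h
  have hc := differentiableAt_vec3_coord k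
  refine differentiableAt_euclidean.mpr fun i => ?_
  fin_cases i
  · exact ((hc 1).mul (h1.fun_inv h)).neg
  · exact (hc 0).mul (h1.fun_inv h)
  · exact differentiableAt_const _

lemma inner_unitTheta {k : Vec3} (h : axisDist k ≠ 0) : inner ℝ (unitTheta k) k = 0 := by
  have hn := norm_ne_zero_of_axisDist h
  have hs := axisDist_sq k
  rw [inner_eq]
  simp only [unitTheta, cosTheta, sinTheta, cosPhi, sinPhi, PiLp.toLp_apply, Matrix.cons_val]
  field_simp
  linear_combination -k 2 * hs

lemma inner_unitPhi (k : Vec3) : inner ℝ (unitPhi k) k = 0 := by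
  rw [inner_eq]
  simp only [unitPhi, cosPhi, sinPhi, PiLp.toLp_apply, Matrix.cons_val]
  ring

lemma cross_unitTheta_unitPhi {k : Vec3} (h : axisDist k ≠ 0) :
    cross (unitTheta k) (unitPhi k) = unitK k := by
  have hn := norm_ne_zero_of_axisDist h
  have hs := axisDist_sq k
  obtain ⟨c0, c1, c2⟩ := cross_apply (unitTheta k) (unitPhi k)
  ext i
  fin_cases i
  · refine c0.trans ?_
    simp [unitTheta, unitPhi, unitK, sinTheta, cosPhi]
    field_simp
  · refine c1.trans ?_
    simp [unitTheta, unitPhi, unitK, sinTheta, sinPhi]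
    field_simp
  · refine c2.trans ?_
    simp [unitTheta, unitPhi, unitK, cosTheta, sinPhi, cosPhi]
    field_simp
    linear_combination -k 2 * hs

/-- The generator `X_a = e_a × k` of the rotations of momentum space. -/
def rotField (a : Fin 3) : Vec3 →L[ℝ] Vec3 :=
  LinearMap.toContinuousLinearMap
    { toFun := fun p => cross (basisVec a) p
      map_add' := fun p q => by simp [cross]
      map_smul' := fun c p => by simp [cross] }

lemma rotField_apply (a : Fin 3) (p : Vec3) : rotField a p = cross (basisVec a) p := rfl

lemma inner_rotField (a : Fin 3) (p : Vec3) : inner ℝ (rotField a p) p = 0 := by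
  obtain ⟨c0, c1, c2⟩ := cross_apply (basisVec a) p
  rw [inner_eq, rotField_apply, c0, c1, c2]
  ring

lemma rotField_values (p : Vec3) :
    rotField 0 p = !₂[0, -p 2, p 1] ∧ rotField 1 p = !₂[p 2, 0, -p 0] ∧
      rotField 2 p = !₂[-p 1, p 0, 0] := by
  refine ⟨?_, ?_, ?_⟩ <;> ext i <;> fin_cases i <;>
    simp [rotField_apply, cross, crossProduct, basisVec]

/-- Linear vector fields Ap and Bp have Lie bracket (BA - AB)p, hence the sign opposite to that of
the matrix commutator. -/
lemma lieBracket_rotField :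
    VectorField.lieBracket ℝ (rotField 0) (rotField 1) = fun p => (-1 : ℝ) • rotField 2 p := by
  funext p
  rw [VectorField.lieBracket, ContinuousLinearMap.fderiv, ContinuousLinearMap.fderiv]
  ext i
  fin_cases i <;> simp [rotField_values]

section Bundles

variable {m : ℝ} {F : Type*} [NormedAddCommGroup F] [NormedSpace ℂ F]
  {E : momentumSpace m → Type*} [TopologicalSpace (TotalSpace F E)]
  [∀ k, NormedAddCommGroup (E k)] [∀ k, InnerProductSpace ℂ (E k)]
  [FiberBundle F E]

namespace BundleRep

variable {ρ : BundleRep F E}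

/-- Valid for every section: if the derivative does not exist, both sides take the default value
zero. Sums, by contrast, need the existence hypotheses of `boostConnection_add`. -/
lemma infAct_const_smul (Z : lorentzAlgebra) (c : ℂ) (χ : ∀ k, E k) :
    ρ.infAct Z (fun p => c • χ p) = fun k => c • ρ.infAct Z χ k := by
  funext k
  simp only [infAct, ρ.sectionAct_smul _ (fun _ => c)]
  exact deriv_fun_const_smul_field c _

lemma boostConnection_const_smul (X : Vec3 → Vec3) (c : ℂ) (χ : ∀ k, E k) :
    ρ.boostConnection X (fun p => c • χ p) = fun k => c • ρ.boostConnection X χ k := by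
  funext k
  simp only [boostConnection_eq, infAct_const_smul, smul_add, smul_comm c]

lemma boostConnection_smul_field (X : Vec3 → Vec3) (c : ℝ) (χ : ∀ k, E k) (k : momentumSpace m) :
    ρ.boostConnection (fun p => c • X p) χ k = c • ρ.boostConnection X χ k := by
  simp only [boostConnection_eq, inner_smul_left, PiLp.smul_apply, smul_eq_mul]
  simp only [conj_trivial]
  module

lemma commutator_rotField {ψ : ∀ k, E k} (k : momentumSpace m) :
    ρ.boostConnection (rotField 0) (ρ.boostConnection (rotField 1) ψ) k -
      ρ.boostConnection (rotField 1) (ρ.boostConnection (rotField 0) ψ) k =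
    curvature ρ.boostConnection (rotField 0) (rotField 1) ψ k -
      ρ.boostConnection (rotField 2) ψ k := by
  rw [curvature, lieBracket_rotField, boostConnection_smul_field]
  module

lemma orbitalPart_apply (a : Fin 3) (ψ : ∀ k, E k) : orbitalPart ρ.boostConnection a ψ = fun k =>
    (-Complex.I) • ρ.boostConnection (rotField a) ψ k := rfl

lemma leviCivita_zero_one : leviCivita 0 1 0 = 0 ∧ leviCivita 0 1 1 = 0 ∧
    leviCivita 0 1 2 = 1 := by
  simp [leviCivita, cross, crossProduct, basisVec]

lemma boostConnection_add (X : Vec3 → Vec3) {χ ξ : ∀ k, E k} {k : momentumSpace m}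
    (hχ : ∀ Z, ρ.HasInfAct Z χ k (ρ.infAct Z χ k)) (hξ : ∀ Z, ρ.HasInfAct Z ξ k (ρ.infAct Z ξ k)) :
    ρ.boostConnection X (fun p => χ p + ξ p) k =
      ρ.boostConnection X χ k + ρ.boostConnection X ξ k := by
  simp only [boostConnection_eq, ((hχ _).add (hξ _)).infAct]
  module

lemma spinPart_apply (a : Fin 3) (ψ : ∀ k, E k) : spinPart ρ ρ.boostConnection a ψ =
    fun k => Complex.I • (ρ.infAct (rotGen a) ψ k + ρ.boostConnection (rotField a) ψ k) := by
  funext k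
  rw [spinPart, orbitalPart_apply, J_eq]
  module

/-- With L_a = -i D_{X_a} and [X_0, X_1] = -X_2, the defect [L_0, L_1] - iL_2 is -F(X_0, X_1). -/
lemma curvature_eq_zero_of_orbitalPart (h : IsAngularMomentum F (orbitalPart ρ.boostConnection))
    {ψ : ∀ k, E k} (hψ : IsSmoothSection F ψ) (hc : HasCompactSupp ψ) (k : momentumSpace m) :
    curvature ρ.boostConnection (rotField 0) (rotField 1) ψ k = 0 := by
  have h1 := h ψ hψ hc 0 1 k
  have h2 := commutator_rotField (ρ := ρ) (ψ := ψ) k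
  simp only [orbitalPart_apply, boostConnection_const_smul, Fin.sum_univ_three,
    leviCivita_zero_one] at h1
  simp only [smul_smul, Complex.I_mul_I, Complex.ofReal_zero, mul_zero, zero_mul,
    Complex.ofReal_one, mul_one, mul_neg, neg_mul, neg_neg, one_smul] at h1
  linear_combination (norm := module) -h2 - h1

variable [VectorBundle ℝ F E]

theorem curvature_orthogonal {ψ : ∀ k, E k} (hψ : IsSmoothSection F ψ) (k : momentumSpace m)
    {X Y : Vec3 → Vec3} (hX : DifferentiableAt ℝ X k) (hY : DifferentiableAt ℝ Y k)
    (hXk : inner ℝ (X k) (k : Vec3) = 0) (hYk : inner ℝ (Y k) (k : Vec3) = 0) :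
    curvature ρ.boostConnection X Y ψ k = -(energy m k)⁻¹ ^ 2 •
      (cross (X k) (Y k) 0 • ρ.infAct (rotGen 0) ψ k +
        cross (X k) (Y k) 1 • ρ.infAct (rotGen 1) ψ k +
        cross (X k) (Y k) 2 • ρ.infAct (rotGen 2) ψ k) := by
  rw [curvature_boostConnection hψ k hX hY, hXk, hYk]
  simp

theorem curvature_eq_dotJ {ψ : ∀ k, E k} (hψ : IsSmoothSection F ψ) (k : momentumSpace m)
    {X Y U : Vec3 → Vec3} (hX : DifferentiableAt ℝ X k) (hY : DifferentiableAt ℝ Y k)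
    (hXk : inner ℝ (X k) (k : Vec3) = 0) (hYk : inner ℝ (Y k) (k : Vec3) = 0)
    (hU : cross (X k) (Y k) = U k) :
    curvature ρ.boostConnection X Y ψ k =
      (Complex.I / (energy m k : ℂ) ^ 2) • ρ.dotJ U ψ k := by
  have h : (energy m k : ℂ) ≠ 0 := by exact_mod_cast (energy_pos k).ne'
  rw [curvature_orthogonal hψ k hX hY hXk hYk, hU]
  simp only [dotJ, Fin.sum_univ_three, J_eq, ← Complex.coe_smul]
  push_cast
  have hI : Complex.I ^ 2 = -1 := Complex.I_sq
  match_scalars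
  all_goals
    field_simp
    rw [hI]
    ring

/-- The curvature in the rotational directions at a point of the third axis. -/
lemma curvature_rotField {ψ : ∀ k, E k} (hψ : IsSmoothSection F ψ) (k : momentumSpace m) {s : ℝ}
    (hk : (k : Vec3) = s • basisVec 2) :
    curvature ρ.boostConnection (rotField 0) (rotField 1) ψ k =
      -((energy m k)⁻¹ ^ 2 * s ^ 2) • ρ.infAct (rotGen 2) ψ k := by
  rw [curvature_orthogonal hψ k (rotField 0).differentiableAt (rotField 1).differentiableAt
    (inner_rotField 0 _) (inner_rotField 1 _)]
  obtain ⟨c0, c1, c2⟩ := cross_apply (rotField 0 (k : Vec3)) (rotField 1 (k : Vec3))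
  rw [c0, c1, c2, (rotField_values _).1, (rotField_values _).2.1, hk]
  simp [basisVec]
  module

/-- Rotation covariance of the connection: commuting R_a with D_{X_b} rotates the field X_b.
Together the two identities supply the cross terms of [S_0, S_1]. -/
lemma equivariance_rotField {ψ : ∀ k, E k} (hψ : IsSmoothSection F ψ) (k : momentumSpace m) :
    ρ.infAct (rotGen 0) (ρ.boostConnection (rotField 1) ψ) k =
      ρ.boostConnection (rotField 1) (ρ.infAct (rotGen 0) ψ) k +
        ρ.boostConnection (rotField 2) ψ k ∧
    ρ.infAct (rotGen 1) (ρ.boostConnection (rotField 0) ψ) k =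
      ρ.boostConnection (rotField 0) (ρ.infAct (rotGen 1) ψ) k -
        ρ.boostConnection (rotField 2) ψ k := by
  have h := fun a b => sub_eq_iff_eq_add.mp
    (infAct_commutator (ρ := ρ) hψ (rotGen a) (boostGen b) k)
  obtain ⟨b00, b01, b02, b10, b11, b12⟩ := bracket_rot_boost
  have h00 := h 0 0
  have h01 := h 0 1
  have h02 := h 0 2
  have h10 := h 1 0
  have h11 := h 1 1
  have h12 := h 1 2
  rw [b00, infAct_smul hψ] at h00
  rw [b01] at h01
  rw [b02, infAct_smul hψ] at h02
  rw [b10, infAct_smul hψ] at h10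
  rw [b11, infAct_smul hψ] at h11
  rw [b12] at h12
  obtain ⟨v0, v1, v2⟩ := rotField_values (k : Vec3)
  constructor
  · rw [(hasInfAct_boostConnection hψ k (rotField 1).hasFDerivAt (rotGen 0)
        (infMomentum_rotGen 0 k)).infAct, ← rotField_apply]
    simp only [boostConnection_eq, h00, h01, h02, inner_eq, v0, v1, v2,
      (rotField_values _).2.1, PiLp.toLp_apply, Matrix.cons_val]
    module
  · rw [(hasInfAct_boostConnection hψ k (rotField 0).hasFDerivAt (rotGen 1)
        (infMomentum_rotGen 1 k)).infAct, ← rotField_apply]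
    simp only [boostConnection_eq, h10, h11, h12, inner_eq, v0, v1, v2,
      (rotField_values _).1, PiLp.toLp_apply, Matrix.cons_val]
    module

/-- Here S_a = i(R_a + D_{X_a}). The commutator of the R's gives R_2, the two cross terms give 2
D_{X_2}, and that of the D's gives F - D_{X_2}; so [S_0, S_1] - iS_2 = -F(X_0, X_1). -/
lemma curvature_eq_zero_of_spinPart (h : IsAngularMomentum F (spinPart ρ ρ.boostConnection))
    {ψ : ∀ k, E k} (hψ : IsSmoothSection F ψ) (hc : HasCompactSupp ψ) (k : momentumSpace m) :
    curvature ρ.boostConnection (rotField 0) (rotField 1) ψ k = 0 := by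
  have h1 := h ψ hψ hc 0 1 k
  have h2 := commutator_rotField (ρ := ρ) (ψ := ψ) k
  have h3 := infAct_commutator (ρ := ρ) hψ (rotGen 0) (rotGen 1) k
  obtain ⟨h4, h5⟩ := equivariance_rotField (ρ := ρ) hψ k
  rw [bracket_rot_rot] at h3
  have hr : ∀ a Z, ρ.HasInfAct Z (ρ.infAct (rotGen a) ψ) k
      (ρ.infAct Z (ρ.infAct (rotGen a) ψ) k) :=
    fun a Z => hasInfAct_infAct_infAct hψ Z (rotGen a) k
  have hD : ∀ a Z, ρ.HasInfAct Z (ρ.boostConnection (rotField a) ψ) k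
      (ρ.infAct Z (ρ.boostConnection (rotField a) ψ) k) := by
    intro a Z
    have := hasInfAct_boostConnection (ρ := ρ) hψ k (rotField a).hasFDerivAt Z rfl
    rw [this.infAct]
    exact this
  simp only [spinPart_apply, boostConnection_const_smul, infAct_const_smul, Fin.sum_univ_three,
    leviCivita_zero_one, ((hr _ _).add (hD _ _)).infAct,
    boostConnection_add _ (hr _) (hD _), ← smul_add] at h1
  simp only [smul_smul, Complex.I_mul_I, Complex.ofReal_zero, mul_zero, zero_mul,
    zero_smul, zero_add, Complex.ofReal_one, mul_one, h4, h5] at h1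
  linear_combination (norm := module) -h1 - h2 - h3

end BundleRep

end Bundles

end BoostCurvature

end

/-! ### Group elements acting trivially on a fibre -/

noncomputable section

namespace BoostCurvature

lemma rotation_add (a : Fin 3) (s t : ℝ) : rotation a (s + t) = rotation a s * rotation a t := by
  simp only [← lorentzExp_rotGen, lorentzExp_add_smul]

lemma rotation_zero (a : Fin 3) : rotation a 0 = 1 := by
  rw [← lorentzExp_rotGen, zero_smul, lorentzExp_zero]

lemma rotation_neg (a : Fin 3) (t : ℝ) : rotation a (-t) = (rotation a t)⁻¹ := by
  rw [eq_inv_iff_mul_eq_one, ← rotation_add, neg_add_cancel, rotation_zero]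

lemma rotation_two_smul {m : ℝ} {k : momentumSpace m} {s : ℝ} (hk : (k : Vec3) = s • basisVec 2)
    (t : ℝ) : Poincare.ofLorentz (rotation 2 t) • k = k := by
  apply Subtype.ext
  rw [coe_ofLorentz_smul]
  change spatial (rotationMatrix 2 t *ᵥ fourMomentum m k) = (k : Vec3)
  rw [hk]
  ext i
  fin_cases i <;>
    simp [rotationMatrix, fourMomentum, spatial, Matrix.mulVec, dotProduct, Fin.sum_univ_succ,
      basisVec]

section Bundles

variable {m : ℝ} {F : Type*} [NormedAddCommGroup F] [NormedSpace ℂ F]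
  {E : momentumSpace m → Type*} [TopologicalSpace (TotalSpace F E)]
  [∀ k, NormedAddCommGroup (E k)] [∀ k, InnerProductSpace ℂ (E k)]
  [FiberBundle F E]

namespace BundleRep

/-- `g` fixes the momentum `k` and acts trivially on the internal states over `k`. -/
def FixesFibre (ρ : BundleRep F E) (g : Poincare) (k : momentumSpace m) : Prop :=
  g • k = k ∧ ∀ ψ : (∀ k, E k), ρ.sectionAct g ψ k = ψ k

variable {ρ : BundleRep F E}

lemma FixesFibre.mul {g h : Poincare} {k : momentumSpace m} (hg : ρ.FixesFibre g k)
    (hh : ρ.FixesFibre h k) : ρ.FixesFibre (g * h) k :=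
  ⟨by rw [mul_smul, hh.1, hg.1], fun ψ => by rw [sectionAct_mul, hg.2, hh.2]⟩

lemma FixesFibre.conj {g h : Poincare} {k k' : momentumSpace m} (hh : ρ.FixesFibre h k')
    (hg : g • k' = k) : ρ.FixesFibre (g * h * g⁻¹) k := by
  refine ⟨by rw [mul_smul, mul_smul, ← hg, inv_smul_smul, hh.1], fun ψ => ?_⟩
  rw [sectionAct_mul, sectionAct_mul, ρ.sectionAct_apply_of_eq g _ hg, hh.2,
    ← ρ.sectionAct_apply_of_eq g _ hg, ← sectionAct_mul, mul_inv_cancel, sectionAct_one]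

lemma FixesFibre.act_eq {g : Poincare} {k : momentumSpace m} (hg : ρ.FixesFibre g k)
    (h : g • k = k) (v : E k) : ρ.act g h v = v := by
  classical
  -- `FixesFibre` quantifies over arbitrary sections, so v may be extended by zero.
  have := hg.2 (Function.update 0 k v)
  rwa [ρ.sectionAct_apply_of_eq g _ h, Function.update_self] at this

lemma fixesFibre_of_act_eq {g : Poincare} {k : momentumSpace m} (h : g • k = k)
    (hg : ∀ v : E k, ρ.act g h v = v) : ρ.FixesFibre g k :=
  ⟨h, fun ψ => by rw [ρ.sectionAct_apply_of_eq g _ h, hg]⟩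

end BundleRep

variable [VectorBundle ℝ F E] [ContMDiffVectorBundle ∞ F E 𝓘(ℝ, Vec3)]

/-- Every vector extends to a smooth section with compact support. -/
lemma exists_smooth_section {k : momentumSpace m} (v : E k) :
    ∃ ψ : ∀ k, E k, IsSmoothSection F ψ ∧ HasCompactSupp ψ ∧ ψ k = v := by
  obtain ⟨s, hs, hσ⟩ := FiberBundle.exists_contMDiffOn_extend (k := ∞) 𝓘(ℝ, Vec3) F v
  -- The closed support of the bump function lies where the local extension is smooth, so the
  -- product continues smoothly by zero.
  obtain ⟨f, -, hf⟩ := (SmoothBumpFunction.nhds_basis_tsupport (I := 𝓘(ℝ, Vec3)) k).mem_iff.mp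
    (interior_mem_nhds.mpr hs)
  refine ⟨fun x => f x • FiberBundle.extend F v x, fun x => ?_, ?_, ?_⟩
  · by_cases hx : x ∈ tsupport f
    · have h1 := (hσ.mono interior_subset).contMDiffAt (isOpen_interior.mem_nhds (hf hx))
      exact f.contMDiff.contMDiffAt.smul_section h1
    · refine (contMDiff_zeroSection ℝ E x).congr_of_eventuallyEq ?_
      filter_upwards [(isClosed_tsupport f).isOpen_compl.mem_nhds hx] with y hy
      rw [image_eq_zero_of_notMem_tsupport hy, zero_smul]
      rfl
  · refine f.hasCompactSupport.of_isClosed_subset isClosed_closure (closure_mono fun x hx => ?_)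
    simp only [Set.mem_ofPred_eq, Function.mem_support] at hx ⊢
    contrapose! hx
    rw [hx, zero_smul]
  · simp

namespace BundleRep

variable {ρ : BundleRep F E}

/-- If the infinitesimal rotation about the third axis vanishes on the fibre over a point of this
axis then all these rotations act trivially on this fibre. -/
lemma fixesFibre_rotation {k : momentumSpace m} {s : ℝ} (hk : (k : Vec3) = s • basisVec 2)
    (h : ∀ ψ : (∀ k, E k), IsSmoothSection F ψ → HasCompactSupp ψ → ρ.infAct (rotGen 2) ψ k = 0)
    (t : ℝ) : ρ.FixesFibre (Poincare.ofLorentz (rotation 2 t)) k := by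
  have hfix := rotation_two_smul hk
  have h0 : ∀ v : E k, HasDerivAt
      (fun t => ρ.act (Poincare.ofLorentz (rotation 2 t)) (hfix t) v) 0 0 := by
    intro v
    obtain ⟨ψ, hψ, hc, rfl⟩ := exists_smooth_section (F := F) v
    have h1 := hasInfAct_infAct (ρ := ρ) (Z := rotGen 2) hψ k
    rw [h ψ hψ hc] at h1
    simp only [HasInfAct, lorentzExp_rotGen] at h1
    refine h1.congr_of_eventuallyEq (Filter.Eventually.of_forall fun t => ?_)
    exact (ρ.sectionAct_apply_of_eq _ ψ (hfix t)).symm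
  refine fixesFibre_of_act_eq (hfix t) fun v => ?_
  -- The group law moves the derivative at t₀ to the one at 0, which vanishes on every vector; the
  -- orbit of v is therefore constant.
  have hadd : ∀ t₀ t, ρ.act (Poincare.ofLorentz (rotation 2 t)) (hfix t) v =
      ρ.act (Poincare.ofLorentz (rotation 2 (t - t₀))) (hfix (t - t₀))
        (ρ.act (Poincare.ofLorentz (rotation 2 t₀)) (hfix t₀) v) := by
    intro t₀ t
    rw [← ρ.act_mul]
    simp only [← ofLorentz_mul, ← rotation_add, sub_add_cancel]
  have h1 : ∀ t₀, HasDerivAt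
      (fun t => ρ.act (Poincare.ofLorentz (rotation 2 t)) (hfix t) v) 0 t₀ := by
    intro t₀
    rw [funext (hadd t₀)]
    have h2 := h0 (ρ.act (Poincare.ofLorentz (rotation 2 t₀)) (hfix t₀) v)
    rw [← sub_self t₀] at h2
    exact h2.comp_sub_const t₀ t₀
  have h2 := is_const_of_deriv_eq_zero (fun t => (h1 t).differentiableAt)
    (fun t => (h1 t).deriv) t 0
  rw [h2]
  have h3 : ∀ g (hg : g • k = k), g = 1 → ρ.act g hg v = v := by
    rintro _ _ rfl
    exact ρ.act_one k v
  exact h3 _ _ (by rw [rotation_zero, ofLorentz_one])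

/-- The origin of momentum space, for a massive particle. -/
def origin (hm : m ≠ 0) : momentumSpace m := ⟨0, Or.inl hm⟩

/-- The curvature carries a factor s² and says nothing at the origin. Along the axis, the sections
Λψ and ψ agree off the origin and are continuous, hence agree there too. -/
lemma fixesFibre_origin (hm : m ≠ 0) {Λ : RestrictedLorentz}
    (hΛ : Poincare.ofLorentz Λ • origin hm = origin hm)
    (h : ∀ (k : momentumSpace m) (s : ℝ), s ≠ 0 → (k : Vec3) = s • basisVec 2 →
      ρ.FixesFibre (Poincare.ofLorentz Λ) k) :
    ρ.FixesFibre (Poincare.ofLorentz Λ) (origin hm) := by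
  refine fixesFibre_of_act_eq hΛ fun v => ?_
  obtain ⟨ψ, hψ, -, rfl⟩ := exists_smooth_section (F := F) v
  rw [← ρ.sectionAct_apply_of_eq _ ψ hΛ]
  let c : EuclideanSpace ℝ (Fin 1) → momentumSpace m := fun x => ⟨x 0 • basisVec 2, Or.inl hm⟩
  have hc : ContDiff ℝ ∞ fun x => (c x : Vec3) :=
    (EuclideanSpace.proj (0 : Fin 1) : EuclideanSpace ℝ (Fin 1) →L[ℝ] ℝ).contDiff.smul
      contDiff_const
  have hc0 : c 0 = origin hm := Subtype.ext (by simp [c, origin])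
  rw [← hc0]
  have h1 := contMDiff_sectionAct ρ (γ := fun _ => Λ) (fun _ _ => contDiff_const) hc hψ
  have h2 := contMDiff_sectionAct ρ (γ := fun _ => 1) (fun _ _ => contDiff_const) hc hψ
  simp only [ofLorentz_one, sectionAct_one] at h2
  have h3 := (contMDiffAt_totalSpace.mp (h1 0)).2.continuousAt
  have h4 := (contMDiffAt_totalSpace.mp (h2 0)).2.continuousAt
  have h5 : ∀ x : EuclideanSpace ℝ (Fin 1), x ≠ 0 →
      ρ.sectionAct (Poincare.ofLorentz Λ) ψ (c x) = ψ (c x) := by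
    intro x hx
    refine (h (c x) (x 0) ?_ rfl).2 ψ
    contrapose! hx
    ext i
    rw [Subsingleton.elim i 0, hx]
    rfl
  have h6 := tendsto_nhds_unique_of_eventuallyEq
    (h3.tendsto.mono_left (nhdsWithin_le_nhds (s := {0}ᶜ)))
    (h4.tendsto.mono_left (nhdsWithin_le_nhds (s := {0}ᶜ)))
    (by
      filter_upwards [self_mem_nhdsWithin] with x hx
      rw [h5 x hx])
  exact ((trivializationAt F E (c 0)).continuousLinearEquivAt ℝ (c 0)
    (FiberBundle.mem_baseSet_trivializationAt F E (c 0))).injective h6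

end BundleRep

end Bundles

end BoostCurvature

end

noncomputable section

namespace BoostCurvature

/-! ### Little groups -/

lemma exists_polar (x y : ℝ) : ∃ t, x = √(x ^ 2 + y ^ 2) * Real.cos t ∧
    y = √(x ^ 2 + y ^ 2) * Real.sin t := by
  have h : ‖(⟨x, y⟩ : ℂ)‖ = √(x ^ 2 + y ^ 2) := by
    rw [Complex.norm_def, Complex.normSq_mk]
    congr 1
    ring
  refine ⟨Complex.arg ⟨x, y⟩, ?_, ?_⟩
  · rw [← h, Complex.norm_mul_cos_arg]
  · rw [← h, Complex.norm_mul_sin_arg]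

lemma lorMat_rotation (a : Fin 3) (t : ℝ) : lorMat (rotation a t) = rotationMatrix a t := rfl

lemma lorMat_boost (a : Fin 3) (t : ℝ) : lorMat (boost a t) = boostMatrix a t := rfl

/-- The third axis can be rotated into any direction. -/
lemma exists_rotation (w : Vec3) : ∃ φ θ, ∀ e : ℝ,
    lorMat (rotation 2 φ * rotation 1 θ) *ᵥ ![e, 0, 0, ‖w‖] = ![e, w 0, w 1, w 2] := by
  obtain ⟨φ, h0, h1⟩ := exists_polar (w 0) (w 1)
  obtain ⟨θ, h2, h3⟩ := exists_polar (w 2) (√(w 0 ^ 2 + w 1 ^ 2))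
  have hn : √(w 2 ^ 2 + √(w 0 ^ 2 + w 1 ^ 2) ^ 2) = ‖w‖ := by
    rw [Real.sq_sqrt (by positivity), EuclideanSpace.norm_eq, Fin.sum_univ_three]
    simp only [Real.norm_eq_abs, sq_abs]
    congr 1
    ring
  rw [hn] at h2 h3
  refine ⟨φ, θ, fun e => ?_⟩
  rw [lorMat_mul, ← Matrix.mulVec_mulVec, lorMat_rotation, lorMat_rotation]
  have hr : rotationMatrix 1 θ *ᵥ ![e, 0, 0, ‖w‖] = ![e, √(w 0 ^ 2 + w 1 ^ 2), 0, w 2] := by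
    ext i
    fin_cases i <;> simp [rotationMatrix, Matrix.mulVec, dotProduct, Fin.sum_univ_succ]
    · linarith
    · linarith
  rw [hr]
  ext i
  fin_cases i <;> simp [rotationMatrix, Matrix.mulVec, dotProduct, Fin.sum_univ_succ]
  · linarith
  · linarith

lemma lorMat_form_apply (Λ : RestrictedLorentz) (i j : Fin 4) :
    lorMat Λ 0 i * lorMat Λ 0 j - lorMat Λ 1 i * lorMat Λ 1 j - lorMat Λ 2 i * lorMat Λ 2 j -
      lorMat Λ 3 i * lorMat Λ 3 j = minkowski i j := by
  have h := congrFun (congrFun (lorMat_form Λ) i) j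
  rw [← h]
  simp [Matrix.mul_apply, Fin.sum_univ_succ, minkowski, Matrix.diagonal_apply]
  ring

lemma det_lorMat (Λ : RestrictedLorentz) : (lorMat Λ).det = 1 := Λ.1.2

/-- A Lorentz transformation which fixes time and the third axis is a rotation about this axis. -/
lemma eq_rotation_of_fixes (Λ : RestrictedLorentz) (h0 : lorMat Λ *ᵥ ![1, 0, 0, 0] = ![1, 0, 0, 0])
    (h3 : lorMat Λ *ᵥ ![0, 0, 0, 1] = ![0, 0, 0, 1]) : ∃ t, Λ = rotation 2 t := by
  have a0 : ∀ i, lorMat Λ i 0 = ![1, 0, 0, 0] i := fun i => by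
    rw [← h0]
    simp [Matrix.mulVec, dotProduct, Fin.sum_univ_succ]
  have a3 : ∀ i, lorMat Λ i 3 = ![0, 0, 0, 1] i := fun i => by
    rw [← h3]
    simp [Matrix.mulVec, dotProduct, Fin.sum_univ_succ]
  have e00 := a0 0
  have e10 := a0 1
  have e20 := a0 2
  have e30 := a0 3
  have e03 := a3 0
  have e13 := a3 1
  have e23 := a3 2
  have e33 := a3 3
  have f01 := lorMat_form_apply Λ 0 1
  have f02 := lorMat_form_apply Λ 0 2
  have f31 := lorMat_form_apply Λ 3 1
  have f32 := lorMat_form_apply Λ 3 2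
  have f11 := lorMat_form_apply Λ 1 1
  have f22 := lorMat_form_apply Λ 2 2
  have f12 := lorMat_form_apply Λ 1 2
  simp at e00 e10 e20 e30 e03 e13 e23 e33
  simp [minkowski, e00, e10, e20, e30, e03, e13, e23, e33] at f01 f02 f31 f32
  simp [minkowski, f01, f02, f31, f32] at f11 f22 f12
  have hM : lorMat Λ = !![1, 0, 0, 0; 0, lorMat Λ 1 1, lorMat Λ 1 2, 0;
      0, lorMat Λ 2 1, lorMat Λ 2 2, 0; 0, 0, 0, 1] := by
    ext i j
    fin_cases i <;> fin_cases j <;> simp [*]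
  have hd := det_lorMat Λ
  rw [hM] at hd
  simp [Matrix.det_succ_row_zero, Fin.sum_univ_succ, Fin.succAbove] at hd
  obtain ⟨t, hc, hs⟩ := exists_polar (lorMat Λ 1 1) (lorMat Λ 2 1)
  have h1 : lorMat Λ 1 1 ^ 2 + lorMat Λ 2 1 ^ 2 = 1 := by linarith
  rw [h1, Real.sqrt_one, one_mul] at hc hs
  -- The first column of the block is a unit vector; orthogonality and determinant one make the
  -- second column its quarter turn.
  have hd22 : lorMat Λ 2 2 = lorMat Λ 1 1 := by
    linear_combination (-lorMat Λ 2 2) * h1 + lorMat Λ 1 1 * hd - lorMat Λ 2 1 * f12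
  have hd12 : lorMat Λ 1 2 = -lorMat Λ 2 1 := by
    linear_combination (-lorMat Λ 1 2) * h1 - lorMat Λ 2 1 * hd - lorMat Λ 1 1 * f12
  refine ⟨t, lorMat_injective ?_⟩
  rw [hM, hd22, hd12, hc, hs]
  rfl

lemma lorMat_fourMomentum_of_fixes {m : ℝ} {Λ : RestrictedLorentz} {k k' : momentumSpace m}
    (h : Poincare.ofLorentz Λ • k = k') : lorMat Λ *ᵥ fourMomentum m k = fourMomentum m k' := by
  rw [← h, coe_ofLorentz_smul, fourMomentum_lorentz]

lemma smul_eq_of_lorMat {m : ℝ} {Λ : RestrictedLorentz} {k k' : momentumSpace m}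
    (h : lorMat Λ *ᵥ fourMomentum m k = fourMomentum m k') : Poincare.ofLorentz Λ • k = k' := by
  apply Subtype.ext
  rw [coe_ofLorentz_smul, h, spatial_fourMomentum]

lemma fourMomentum_eq (m : ℝ) (k : Vec3) : fourMomentum m k = ![energy m k, k 0, k 1, k 2] := by
  ext i
  fin_cases i <;> rfl

lemma energy_norm_smul (m : ℝ) (k : Vec3) : energy m (‖k‖ • basisVec 2) = energy m k := by
  simp [energy, norm_smul, basisVec]

lemma exists_rotation_momentum {m : ℝ} {k k' : momentumSpace m}
    (h : (k' : Vec3) = ‖(k : Vec3)‖ • basisVec 2) :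
    ∃ Λ, Poincare.ofLorentz Λ • k' = k := by
  obtain ⟨φ, θ, hr⟩ := exists_rotation (k : Vec3)
  refine ⟨rotation 2 φ * rotation 1 θ, smul_eq_of_lorMat (Eq.trans ?_ ((hr (energy m k)).trans ?_))⟩
  · rw [fourMomentum_eq, h, energy_norm_smul]
    simp [basisVec]
  · rw [fourMomentum_eq]

/-- A null rotation. -/
def nullMatrix (a b : ℝ) : Matrix (Fin 4) (Fin 4) ℝ :=
  !![1 + (a ^ 2 + b ^ 2) / 2, a, b, -((a ^ 2 + b ^ 2) / 2);
    a, 1, 0, -a;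
    b, 0, 1, -b;
    (a ^ 2 + b ^ 2) / 2, a, b, 1 - (a ^ 2 + b ^ 2) / 2]

/-- The null rotations, which fix the light-like vector `(1, 0, 0, 1)`. -/
def nullRotation (a b : ℝ) : RestrictedLorentz :=
  ⟨⟨nullMatrix a b, by
    simp [nullMatrix, Matrix.det_succ_row_zero, Fin.sum_univ_succ, Fin.succAbove]
    ring⟩, by
    refine ⟨?_, ?_⟩
    · ext i j
      fin_cases i <;> fin_cases j <;>
        simp [nullMatrix, minkowski, Matrix.mul_apply, Fin.sum_univ_succ,
          Matrix.diagonal_apply] <;> ring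
    · simp only [nullMatrix]
      change 0 < 1 + (a ^ 2 + b ^ 2) / 2
      positivity⟩

lemma lorMat_nullRotation (a b : ℝ) : lorMat (nullRotation a b) = nullMatrix a b := rfl

lemma nullRotation_add (a b a' b' : ℝ) :
    nullRotation (a + a') (b + b') = nullRotation a b * nullRotation a' b' := by
  apply lorMat_injective
  rw [lorMat_mul]
  simp only [lorMat_nullRotation]
  ext i j
  fin_cases i <;> fin_cases j <;> simp [nullMatrix, Matrix.mul_apply, Fin.sum_univ_succ] <;> ring

lemma nullRotation_zero : nullRotation 0 0 = 1 := by
  apply lorMat_injective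
  rw [lorMat_one, lorMat_nullRotation]
  ext i j
  fin_cases i <;> fin_cases j <;> simp [nullMatrix]

lemma nullRotation_neg (a b : ℝ) : nullRotation (-a) (-b) = (nullRotation a b)⁻¹ := by
  rw [eq_inv_iff_mul_eq_one, ← nullRotation_add, neg_add_cancel, neg_add_cancel,
    nullRotation_zero]

/-- The half turn acts as -1 on the plane of null rotations, so each of them is a commutator of its
half with the half turn. -/
lemma rotation_pi_nullRotation (a b : ℝ) :
    rotation 2 Real.pi * nullRotation a b = nullRotation (-a) (-b) * rotation 2 Real.pi := by
  apply lorMat_injective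
  simp only [lorMat_mul, lorMat_nullRotation, lorMat_rotation]
  ext i j
  fin_cases i <;> fin_cases j <;>
    simp [nullMatrix, rotationMatrix, Matrix.mul_apply, Fin.sum_univ_succ]

/-- A null rotation is the product of a half turn and a conjugate half turn. -/
lemma nullRotation_eq (a b : ℝ) : nullRotation a b =
    nullRotation (a / 2) (b / 2) * rotation 2 Real.pi * (nullRotation (a / 2) (b / 2))⁻¹ *
      rotation 2 (-Real.pi) := by
  rw [← nullRotation_neg, mul_assoc (nullRotation _ _), rotation_pi_nullRotation, rotation_neg]
  simp only [neg_neg, mul_assoc, mul_inv_cancel, mul_one]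
  rw [← nullRotation_add, add_halves, add_halves]

/-- The little group of a light-like vector consists of null rotations and rotations. -/
lemma exists_nullRotation (Λ : RestrictedLorentz)
    (h : lorMat Λ *ᵥ ![1, 0, 0, 1] = ![1, 0, 0, 1]) :
    ∃ a b t, Λ = nullRotation a b * rotation 2 t := by
  have hp : ∀ i, lorMat Λ i 0 + lorMat Λ i 3 = ![1, 0, 0, 1] i := fun i => by
    rw [← h]
    simp [Matrix.mulVec, dotProduct, Fin.sum_univ_succ]
  have p0 := hp 0
  have p1 := hp 1
  have p2 := hp 2
  have p3 := hp 3
  have f00 := lorMat_form_apply Λ 0 0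
  have f03 := lorMat_form_apply Λ 0 3
  simp [minkowski] at p0 p1 p2 p3 f00 f03
  -- Invariance of the Minkowski product of (1, 0, 0, 0) with the fixed vector (1, 0, 0, 1).
  have hd : lorMat Λ 0 0 - lorMat Λ 3 0 = 1 := by
    linear_combination f00 + f03 - lorMat Λ 0 0 * p0 + lorMat Λ 1 0 * p1 + lorMat Λ 2 0 * p2 +
      lorMat Λ 3 0 * p3
  have h00 : lorMat Λ 0 0 = 1 + (lorMat Λ 1 0 ^ 2 + lorMat Λ 2 0 ^ 2) / 2 := by
    linear_combination (1 / 2) * f00 - (1 / 2) * (lorMat Λ 0 0 + lorMat Λ 3 0 - 1) * hd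
  -- With these parameters the null rotation agrees with Λ on (1, 0, 0, 0) as well as on the null
  -- vector; what remains is a rotation about the axis.
  set a := lorMat Λ 1 0 with ha
  set b := lorMat Λ 2 0 with hb
  have hN : ∃ t, (nullRotation a b)⁻¹ * Λ = rotation 2 t := by
    have g0 : lorMat ((nullRotation a b)⁻¹ * Λ) *ᵥ ![1, 0, 0, 0] = ![1, 0, 0, 0] := by
      have : lorMat Λ *ᵥ ![1, 0, 0, 0] = lorMat (nullRotation a b) *ᵥ ![1, 0, 0, 0] := by
        rw [lorMat_nullRotation]
        ext i
        fin_cases i <;> simp [nullMatrix, Matrix.mulVec, dotProduct, Fin.sum_univ_succ] <;> linarith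
      rw [lorMat_mul, ← Matrix.mulVec_mulVec, this, Matrix.mulVec_mulVec, lorMat_inv_mul,
        Matrix.one_mulVec]
    have gp : lorMat ((nullRotation a b)⁻¹ * Λ) *ᵥ ![1, 0, 0, 1] = ![1, 0, 0, 1] := by
      have : lorMat Λ *ᵥ ![1, 0, 0, 1] = lorMat (nullRotation a b) *ᵥ ![1, 0, 0, 1] := by
        rw [h, lorMat_nullRotation]
        ext i
        fin_cases i <;> simp [nullMatrix, Matrix.mulVec, dotProduct, Fin.sum_univ_succ]
      rw [lorMat_mul, ← Matrix.mulVec_mulVec, this, Matrix.mulVec_mulVec, lorMat_inv_mul,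
        Matrix.one_mulVec]
    refine eq_rotation_of_fixes _ g0 ?_
    have : (![0, 0, 0, 1] : Fin 4 → ℝ) = ![1, 0, 0, 1] - ![1, 0, 0, 0] := by
      ext i
      fin_cases i <;> simp
    rw [this, Matrix.mulVec_sub, gp, g0]
  obtain ⟨t, ht⟩ := hN
  exact ⟨a, b, t, by rw [← ht, mul_inv_cancel_left]⟩

/-- Euler angles. -/
lemma exists_euler (Λ : RestrictedLorentz) (h : lorMat Λ *ᵥ ![1, 0, 0, 0] = ![1, 0, 0, 0]) :
    ∃ φ θ t, Λ = rotation 2 φ * rotation 1 θ * rotation 2 t := by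
  have a0 : ∀ i, lorMat Λ i 0 = ![1, 0, 0, 0] i := fun i => by
    rw [← h]
    simp [Matrix.mulVec, dotProduct, Fin.sum_univ_succ]
  have e00 := a0 0
  have e10 := a0 1
  have e20 := a0 2
  have e30 := a0 3
  have f03 := lorMat_form_apply Λ 0 3
  have f33 := lorMat_form_apply Λ 3 3
  simp [minkowski, e00, e10, e20, e30] at f03 f33
  rw [f03] at f33
  -- The image of the last axis, which a product of two rotations reproduces.
  let w : Vec3 := !₂[lorMat Λ 1 3, lorMat Λ 2 3, lorMat Λ 3 3]
  have hw : ‖w‖ = 1 := by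
    rw [EuclideanSpace.norm_eq, Fin.sum_univ_three, Real.sqrt_eq_one]
    simp [w]
    linarith
  obtain ⟨φ, θ, hr⟩ := exists_rotation w
  rw [hw] at hr
  set r := rotation 2 φ * rotation 1 θ
  have r3 : lorMat r *ᵥ ![0, 0, 0, 1] = lorMat Λ *ᵥ ![0, 0, 0, 1] := by
    rw [hr]
    ext i
    fin_cases i <;> simp [Matrix.mulVec, dotProduct, Fin.sum_univ_succ, w, f03]
  have r0 : lorMat r *ᵥ ![1, 0, 0, 0] = lorMat Λ *ᵥ ![1, 0, 0, 0] := by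
    have : (![1, 0, 0, 0] : Fin 4 → ℝ) = ![1, 0, 0, 1] - ![0, 0, 0, 1] := by
      ext i
      fin_cases i <;> simp
    rw [h, this, Matrix.mulVec_sub, hr, hr]
    ext i
    fin_cases i <;> simp
  have hN : ∃ t, r⁻¹ * Λ = rotation 2 t := by
    apply eq_rotation_of_fixes <;>
      rw [lorMat_mul, ← Matrix.mulVec_mulVec]
    · rw [← r0, Matrix.mulVec_mulVec, lorMat_inv_mul, Matrix.one_mulVec]
    · rw [← r3, Matrix.mulVec_mulVec, lorMat_inv_mul, Matrix.one_mulVec]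
  obtain ⟨t, ht⟩ := hN
  exact ⟨φ, θ, t, by rw [← ht, mul_inv_cancel_left]⟩

/-- The quarter turn carries axis 2 to axis 1. -/
lemma rotation_one_conj (θ : ℝ) : rotation 1 θ =
    rotation 0 (-(Real.pi / 2)) * rotation 2 θ * (rotation 0 (-(Real.pi / 2)))⁻¹ := by
  rw [eq_mul_inv_iff_mul_eq]
  apply lorMat_injective
  simp only [lorMat_mul, lorMat_rotation]
  ext i j
  fin_cases i <;> fin_cases j <;> simp [rotationMatrix, Matrix.mul_apply, Fin.sum_univ_succ]

lemma fourMomentum_origin {m : ℝ} (hm : 0 < m) :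
    fourMomentum m (BundleRep.origin hm.ne' : Vec3) = m • ![1, 0, 0, 0] := by
  rw [fourMomentum_eq]
  ext i
  fin_cases i <;> simp [energy, BundleRep.origin, Real.sqrt_sq hm.le]

lemma exists_boost_momentum {m : ℝ} (hm : 0 < m) (k : momentumSpace m) :
    ∃ Λ, Poincare.ofLorentz Λ • BundleRep.origin hm.ne' = k := by
  obtain ⟨Λ, hΛ⟩ := exists_rotation_momentum
    (k := k) (k' := ⟨‖(k : Vec3)‖ • basisVec 2, Or.inl hm.ne'⟩) rfl
  -- The rapidity is chosen so that m sinh t = |k|.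
  refine ⟨Λ * boost 2 (Real.arsinh (‖(k : Vec3)‖ / m)), ?_⟩
  rw [ofLorentz_mul, mul_smul]
  refine Eq.trans ?_ hΛ
  congr 1
  apply Subtype.ext
  rw [coe_ofLorentz_smul, fourMomentum_origin hm, lorMat_boost]
  ext i
  fin_cases i <;>
    simp [spatial, boostMatrix, Matrix.mulVec, dotProduct, Fin.sum_univ_succ, basisVec]
  field_simp

lemma rotation_smul_origin {m : ℝ} (hm : 0 < m) (a : Fin 3) (t : ℝ) :
    Poincare.ofLorentz (rotation a t) • BundleRep.origin hm.ne' = BundleRep.origin hm.ne' := by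
  apply smul_eq_of_lorMat
  rw [fourMomentum_origin hm, Matrix.mulVec_smul, lorMat_rotation]
  congr 1
  ext i
  fin_cases a <;> fin_cases i <;>
    simp [rotationMatrix, Matrix.mulVec, dotProduct, Fin.sum_univ_succ]

/-! ### Triviality of the little groups -/

section Bundles

variable {m : ℝ} {F : Type*} [NormedAddCommGroup F] [NormedSpace ℂ F]
  {E : momentumSpace m → Type*} [TopologicalSpace (TotalSpace F E)]
  [∀ k, NormedAddCommGroup (E k)] [∀ k, InnerProductSpace ℂ (E k)]
  [FiberBundle F E]

namespace BundleRep

variable {ρ : BundleRep F E}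

/-- Little groups along an orbit are conjugate, so one representative momentum suffices. -/
lemma fixesFibre_transport {k k' : momentumSpace m} {g : RestrictedLorentz}
    (hg : Poincare.ofLorentz g • k' = k)
    (h : ∀ Λ, Poincare.ofLorentz Λ • k' = k' → ρ.FixesFibre (Poincare.ofLorentz Λ) k')
    {Λ : RestrictedLorentz} (hΛ : Poincare.ofLorentz Λ • k = k) :
    ρ.FixesFibre (Poincare.ofLorentz Λ) k := by
  have h1 := (h (g⁻¹ * Λ * g) (by
    rw [ofLorentz_mul, ofLorentz_mul, mul_smul, mul_smul, hg, hΛ, ofLorentz_inv, ← hg,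
      inv_smul_smul])).conj hg
  rw [← ofLorentz_inv, ← ofLorentz_mul, ← ofLorentz_mul] at h1
  have : g * (g⁻¹ * Λ * g) * g⁻¹ = Λ := by group
  rwa [this] at h1

variable [VectorBundle ℝ F E] [ContMDiffVectorBundle ∞ F E 𝓘(ℝ, Vec3)]

/-- If the infinitesimal rotations about the third axis vanish on the fibres over this axis then
the particle has spin (or helicity) zero. -/
theorem not_hasNonzeroSpin (hm : 0 ≤ m)
    (h : ∀ (k : momentumSpace m) (s : ℝ), s ≠ 0 → (k : Vec3) = s • basisVec 2 →
      ∀ ψ : (∀ k, E k), IsSmoothSection F ψ → HasCompactSupp ψ → ρ.infAct (rotGen 2) ψ k = 0) :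
    ¬ ρ.HasNonzeroSpin := by
  rintro ⟨k, Λ, hΛ, v, hv⟩
  refine hv (FixesFibre.act_eq ?_ hΛ v)
  have hrot : ∀ (k : momentumSpace m) (s : ℝ), s ≠ 0 → (k : Vec3) = s • basisVec 2 →
      ∀ t, ρ.FixesFibre (Poincare.ofLorentz (rotation 2 t)) k :=
    fun k s hs hk t => fixesFibre_rotation hk (h k s hs hk) t
  rcases hm.eq_or_lt with rfl | hm
  · have hk : (k : Vec3) ≠ 0 := k.2.resolve_left (by simp)
    have hk' : ‖(k : Vec3)‖ • basisVec 2 ∈ momentumSpace 0 :=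
      Or.inr (smul_ne_zero (norm_ne_zero_iff.mpr hk) (by simp [basisVec]))
    obtain ⟨g, hg⟩ := exists_rotation_momentum (k := k) (k' := ⟨_, hk'⟩) rfl
    refine fixesFibre_transport hg (fun Λ hΛ => ?_) hΛ
    have hfm : fourMomentum 0 (‖(k : Vec3)‖ • basisVec 2) = ‖(k : Vec3)‖ • ![1, 0, 0, 1] := by
      rw [fourMomentum_eq]
      ext i
      fin_cases i <;> simp [energy, basisVec, norm_smul]
    have hn : ‖(k : Vec3)‖ ≠ 0 := norm_ne_zero_iff.mpr hk
    have hsmul : ∀ Λ, lorMat Λ *ᵥ ![1, 0, 0, 1] = ![1, 0, 0, 1] →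
        Poincare.ofLorentz Λ • (⟨_, hk'⟩ : momentumSpace 0) = ⟨_, hk'⟩ := by
      intro Λ hΛ
      apply smul_eq_of_lorMat
      simp only [hfm]
      rw [Matrix.mulVec_smul, hΛ]
    have hΛ' := lorMat_fourMomentum_of_fixes hΛ
    simp only [hfm] at hΛ'
    rw [Matrix.mulVec_smul] at hΛ'
    obtain ⟨a, b, t, rfl⟩ := exists_nullRotation Λ (smul_right_injective _ hn hΛ')
    have hr := hrot ⟨_, hk'⟩ _ hn rfl
    have hnull : ∀ a b, lorMat (nullRotation a b) *ᵥ ![1, 0, 0, 1] = ![1, 0, 0, 1] := by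
      intro a b
      rw [lorMat_nullRotation]
      ext i
      fin_cases i <;> simp [nullMatrix, Matrix.mulVec, dotProduct, Fin.sum_univ_succ]
    rw [ofLorentz_mul, nullRotation_eq, ofLorentz_mul, ofLorentz_mul, ofLorentz_mul,
      ofLorentz_inv]
    -- A half turn conjugated by a null rotation that fixes the momentum, an inverse half turn and a
    -- rotation: each is trivial on the fibre.
    exact (((hr Real.pi).conj (hsmul _ (hnull _ _))).mul (hr _)).mul (hr t)
  · obtain ⟨g, hg⟩ := exists_boost_momentum hm k
    refine fixesFibre_transport hg (fun Λ hΛ => ?_) hΛ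
    have hΛ' := lorMat_fourMomentum_of_fixes hΛ
    rw [fourMomentum_origin hm, Matrix.mulVec_smul] at hΛ'
    obtain ⟨φ, θ, t, rfl⟩ := exists_euler Λ (smul_right_injective _ hm.ne' hΛ')
    have h2 : ∀ t, ρ.FixesFibre (Poincare.ofLorentz (rotation 2 t)) (origin hm.ne') := fun t =>
      fixesFibre_origin hm.ne' (rotation_smul_origin hm 2 t) fun k s hs hk => hrot k s hs hk t
    have h1 : ρ.FixesFibre (Poincare.ofLorentz (rotation 1 θ)) (origin hm.ne') := by
      rw [rotation_one_conj, ofLorentz_mul, ofLorentz_mul, ofLorentz_inv]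
      exact (h2 θ).conj (rotation_smul_origin hm 0 _)
    rw [ofLorentz_mul, ofLorentz_mul]
    exact ((h2 φ).mul h1).mul (h2 t)

end BundleRep

end Bundles

end BoostCurvature

end

/-! ### From vanishing curvature to vanishing spin -/

noncomputable section

namespace BoostCurvature

section Bundles

variable {m : ℝ} {F : Type*} [NormedAddCommGroup F] [NormedSpace ℂ F]
  {E : momentumSpace m → Type*} [TopologicalSpace (TotalSpace F E)]
  [∀ k, NormedAddCommGroup (E k)] [∀ k, InnerProductSpace ℂ (E k)]
  [FiberBundle F E] [VectorBundle ℝ F E] [ContMDiffVectorBundle ∞ F E 𝓘(ℝ, Vec3)]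

namespace BundleRep

variable {ρ : BundleRep F E}

/-- If the curvature in the rotational directions vanishes then the spin vanishes. -/
lemma not_hasNonzeroSpin_of_curvature (hm : 0 ≤ m)
    (h : ∀ ψ : (∀ k, E k), IsSmoothSection F ψ → HasCompactSupp ψ →
      ∀ k, curvature ρ.boostConnection (rotField 0) (rotField 1) ψ k = 0) :
    ¬ ρ.HasNonzeroSpin := by
  refine not_hasNonzeroSpin hm fun k s hs hk ψ hψ hc => ?_
  have h1 := h ψ hψ hc k
  rw [curvature_rotField hψ k hk] at h1
  -- The coefficient is -(s/ω)², nonzero because s ≠ 0.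
  refine (smul_eq_zero.mp h1).resolve_left ?_
  have := energy_pos k
  exact neg_ne_zero.mpr (by positivity)

end BundleRep

end Bundles

end BoostCurvature

end

open BoostCurvature
theorem theorem6 {m : ℝ} (hm : 0 ≤ m)
    {F : Type*} [NormedAddCommGroup F] [NormedSpace ℂ F] [FiniteDimensional ℂ F]
    {E : momentumSpace m → Type*} [TopologicalSpace (TotalSpace F E)]
    [∀ k, NormedAddCommGroup (E k)] [∀ k, InnerProductSpace ℂ (E k)]
    [FiberBundle F E] [VectorBundle ℂ F E] [VectorBundle ℝ F E]
    [ContMDiffVectorBundle ∞ F E 𝓘(ℝ, Vec3)]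
    (ρ : BundleRep F E) :
    -- the curvature at `k₀`, in a right-handed orthonormal frame with `u₃ = k₀ / |k₀|`
    (∀ (k₀ : momentumSpace m) (u : Fin 3 → Vec3),
      (k₀ : Vec3) ≠ 0 → Orthonormal ℝ u →
      cross (u 0) (u 1) = u 2 → u 2 = unitK k₀ →
      ∀ X Y : Vec3 → Vec3,
        ContDiffAt ℝ ∞ X k₀ → ContDiffAt ℝ ∞ Y k₀ → X k₀ = u 0 → Y k₀ = u 1 →
        ∀ ψ : (∀ k, E k), IsSmoothSection F ψ →
          curvature ρ.boostConnection X Y ψ k₀ =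
            (Complex.I / (energy m k₀ : ℂ) ^ 2) • ρ.dotJ (fun _ => u 2) ψ k₀) ∧
    -- the same in terms of the spherical unit vector fields
    (∀ k : momentumSpace m, axisDist k ≠ 0 →
      ∀ ψ : (∀ k, E k), IsSmoothSection F ψ →
        curvature ρ.boostConnection unitTheta unitPhi
            ψ k =
          (Complex.I / (energy m k : ℂ) ^ 2) •
            ρ.dotJ unitK ψ k) ∧
    -- for nonzero spin or helicity the connection is not `S²`-flat, and neither `L` nor `S` is an
    -- angular momentum operator
    (ρ.HasNonzeroSpin →
      ¬ IsS2Flat F ρ.boostConnection ∧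
      ¬ IsAngularMomentum F (orbitalPart ρ.boostConnection) ∧
      ¬ IsAngularMomentum F
          (spinPart ρ ρ.boostConnection)) := by
  refine ⟨fun k₀ u hk hu hc h2 X Y hX hY hX0 hY0 ψ hψ => ?_, fun k hk ψ hψ => ?_, fun hs => ?_⟩
  · have hn : ‖(k₀ : Vec3)‖ ≠ 0 := norm_ne_zero_iff.mpr hk
    have hk2 : (k₀ : Vec3) = ‖(k₀ : Vec3)‖ • u 2 := by
      rw [h2, unitK, smul_smul, mul_inv_cancel₀ hn, one_smul]
    have horth : ∀ a, a ≠ 2 → inner ℝ (u a) (k₀ : Vec3) = 0 := by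
      intro a ha
      rw [hk2, inner_smul_right, hu.2 ha, mul_zero]
    refine BundleRep.curvature_eq_dotJ hψ k₀ (hX.differentiableAt (by simp))
      (hY.differentiableAt (by simp)) ?_ ?_ ?_
    · rw [hX0, horth 0 (by decide)]
    · rw [hY0, horth 1 (by decide)]
    · rw [hX0, hY0, hc]
  · exact BundleRep.curvature_eq_dotJ hψ k (differentiableAt_unitTheta hk)
      (differentiableAt_unitPhi hk) (inner_unitTheta hk) (inner_unitPhi _)
      (cross_unitTheta_unitPhi hk)
  · refine ⟨fun h => ?_, fun h => ?_, fun h => ?_⟩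
    -- The rotational fields are smooth and orthogonal to k, hence admissible in `IsS2Flat`.
    · exact BundleRep.not_hasNonzeroSpin_of_curvature hm
        (fun ψ hψ _ k => h _ _ (rotField 0).contDiff.contDiffOn (rotField 1).contDiff.contDiffOn
          (fun _ => inner_rotField 0 _) (fun _ => inner_rotField 1 _) ψ hψ k) hs
    · exact BundleRep.not_hasNonzeroSpin_of_curvature hm
        (fun ψ hψ hc k => BundleRep.curvature_eq_zero_of_orbitalPart h hψ hc k) hs
    · exact BundleRep.not_hasNonzeroSpin_of_curvature hm
        (fun ψ hψ hc k => BundleRep.curvature_eq_zero_of_spinPart h hψ hc k) hs
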